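/- Let $F$ be an arbitrary field and let $A$ be a finite set of positive integers. A set composition of $A$ of length $\ell(P)=l$ is a tuple $P=(P_1,\dots,P_l)$ of mutually disjoint non-empty sets with union $A$. Let $\Pi_A$ be the set of all set compositions of $A$; it is a monoid under $$(P_1,\dots,P_l)\wedge(Q_1,\dots,Q_k)=(P_1\cap Q_1,\dots,P_1\cap Q_k,\;\dots\;,P_l\cap Q_1,\dots,P_l\cap Q_k)^{\#},$$ where $\#$ means that empty sets are deleted. Let $\mathcal A=F\Pi_A$ be its monoid algebra (the Solomon-Tits algebra). Write $Q\preceq P$ if each component of $Q$ is contained in a component of $P$, and let $\Pi_A^<$ be the set of those $(P_1,\dots,P_l)\in\Pi_A$ with $\min P_1<\dots<\min P_l$. Let $\vee$ be the bilinear product on the vector space with basis all set compositions of finite sets of positive integers that concatenates two set compositions if their underlying sets are disjoint and is $0$ on two basis elements otherwise. For non-empty $X$ let $e_X=\sum(-1)^{\ell(P)-1}P$, summed over all $P\in\Pi_X$ with $\min X\in P_1$. For $Q=(Q_1,\dots,Q_k)\in\Pi_A$ put $e_Q=e_{Q_1}\vee\dots\vee e_{Q_k}\in\mathcal A$ (the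 empty product being the empty set composition). All modules are left modules. For a module $M$ let $\mathrm{rad}\,M$ be the intersection of its maximal submodules, let $\mathrm{rad}^{(0)}M=M$ and $\mathrm{rad}^{(k+1)}M=\mathrm{rad}(\mathrm{rad}^{(k)}M)$, and call $\mathrm{rad}^{(k)}M/\mathrm{rad}^{(k+1)}M$ the $k$-th Loewy layer of $M$, for $k\ge 0$. For $Q\in\Pi_A^<$ let $\Lambda_Q=\mathcal A\wedge e_Q$ and $M_Q=\Lambda_Q/\mathrm{rad}\,\Lambda_Q$, and for $T,Q\in\Pi_A^<$ let $C_{T,Q}$ be the multiplicity of $M_T$ in a composition series of $\Lambda_Q$. **Corollary.** Let $Q,T\in\Pi_A^<$ and $k\ge 0$. Then $M_T$ occurs as a direct summand in the $k$-th Loewy layer of $\Lambda_Q$ if and only if $Q\preceq T$ and $\ell(Q)-\ell(T)=k$. In this case, it occurs in that layer with multiplicity $C_{T,Q}$. Moreover, $C_{T,Q}>0$ if and only if $Q\preceq T$. Thus the occurrence of $M_T$ in $\Lambda_Q$ is restricted to a single Loewy layer, if it occurs at all, that is, if $Q\preceq T$. -/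

import Mathlib

namespace SolomonTits

noncomputable section

/-! ### Set compositions -/

/-- A set composition (ordered set partition) of some finite set of positive integers: a tuple of
mutually disjoint non-empty finite sets. -/
@[ext] structure SetComp where
  parts : List (Finset ℕ+)
  nonempty : ∀ p ∈ parts, p.Nonempty
  disjoint : parts.Pairwise Disjoint

/-- Union of a list of finite sets. -/
def unionL (L : List (Finset ℕ+)) : Finset ℕ+ := L.foldr (· ∪ ·) ∅

@[simp] theorem mem_unionL {L : List (Finset ℕ+)} {a : ℕ+} :
    a ∈ unionL L ↔ ∃ p ∈ L, a ∈ p := by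
  induction L with
  | nil => simp [unionL]
  | cons p L ih =>
    have h : unionL (p :: L) = p ∪ unionL L := rfl
    simp [h, ih]

/-- The set of which `P` is a set composition. -/
def SetComp.supp (P : SetComp) : Finset ℕ+ := unionL P.parts

/-- The length of a set composition. -/
def SetComp.length (P : SetComp) : ℕ := P.parts.length

/-- `Comp A` is the set of all set compositions of `A`. -/
def Comp (A : Finset ℕ+) : Type := {P : SetComp // P.supp = A}

namespace Comp

variable {A : Finset ℕ+}

/-- The tuple of components. -/
def parts (P : Comp A) : List (Finset ℕ+) := P.val.parts

/-- The length `ℓ(P)`, the number of components. -/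
def length (P : Comp A) : ℕ := P.val.length

theorem ext_parts {P Q : Comp A} (h : P.parts = Q.parts) : P = Q :=
  Subtype.ext (SetComp.ext h)

/-- Refinement: each component of `Q` is contained in a component of `P`. -/
def Refines (Q P : Comp A) : Prop := ∀ q ∈ Q.parts, ∃ p ∈ P.parts, q ⊆ p

/-- The set compositions `(P₁, …, Pₗ)` with `min P₁ < min P₂ < ⋯ < min Pₗ`. -/
def IsIncreasing (P : Comp A) : Prop := P.parts.Pairwise fun p q => p.min < q.min

/-- The set compositions `(P₁, …, Pₗ)` of `A` with `min A ∈ P₁`. -/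
def MinInFirst (P : Comp A) : Prop := ∃ p ∈ P.parts.head?, ∃ a ∈ p, A.min = a

instance : Finite (Comp A) := by
  have hsub : ∀ P : Comp A, ∀ p ∈ P.parts, p ∈ A.powerset := by
    intro P p hp
    rw [Finset.mem_powerset]
    intro a ha
    have h : P.val.supp = A := P.2
    rw [← h]
    exact mem_unionL.2 ⟨p, hp, ha⟩
  have hnd : ∀ P : Comp A, P.parts.Nodup := by
    intro P
    refine P.val.disjoint.imp_of_mem ?_
    rintro a b ha - hab rfl
    exact (P.val.nonempty a ha).ne_empty (disjoint_self.1 hab)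
  let f : Comp A → {l : List {p // p ∈ A.powerset} // l.Nodup} := fun P =>
    ⟨P.parts.attachWith _ (hsub P), by
      have h := hnd P
      rw [← List.attachWith_map_subtype_val (hsub P)] at h
      exact h.of_map _⟩
  refine Finite.of_injective f ?_
  intro P Q h
  apply ext_parts
  have h2 := congrArg (fun l => l.val.map Subtype.val) h
  simpa [f] using h2

instance : Fintype (Comp A) := Fintype.ofFinite _

end Comp

/-! ### The intersection product -/

/-- The list of all intersections of a component of the first with a component of the second list,
in lexicographic order. -/
def interL (L M : List (Finset ℕ+)) : List (Finset ℕ+) :=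
  L.flatMap fun p => M.map fun q => p ∩ q

/-- Deletion of empty sets. -/
def clean (L : List (Finset ℕ+)) : List (Finset ℕ+) := L.filter fun p => p.Nonempty

theorem unionL_clean (L : List (Finset ℕ+)) : unionL (clean L) = unionL L := by
  ext a
  simp only [mem_unionL, clean, List.mem_filter, decide_eq_true_eq]
  constructor
  · rintro ⟨p, ⟨hp, -⟩, ha⟩
    exact ⟨p, hp, ha⟩
  · rintro ⟨p, hp, ha⟩
    exact ⟨p, ⟨hp, ⟨a, ha⟩⟩, ha⟩

theorem unionL_interL (L M : List (Finset ℕ+)) :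
    unionL (interL L M) = unionL L ∩ unionL M := by
  ext a
  simp only [mem_unionL, interL, List.mem_flatMap, List.mem_map, Finset.mem_inter]
  constructor
  · rintro ⟨_, ⟨p, hp, q, hq, rfl⟩, ha⟩
    exact ⟨⟨p, hp, (Finset.mem_inter.1 ha).1⟩, ⟨q, hq, (Finset.mem_inter.1 ha).2⟩⟩
  · rintro ⟨⟨p, hp, hap⟩, ⟨q, hq, haq⟩⟩
    exact ⟨_, ⟨p, hp, q, hq, rfl⟩, Finset.mem_inter.2 ⟨hap, haq⟩⟩

theorem clean_append (L M : List (Finset ℕ+)) : clean (L ++ M) = clean L ++ clean M :=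
  List.filter_append ..

theorem clean_eq_self {L : List (Finset ℕ+)} (h : ∀ p ∈ L, p.Nonempty) : clean L = L := by
  rw [clean, List.filter_eq_self]
  simpa using h

theorem interL_cons (p : Finset ℕ+) (L M : List (Finset ℕ+)) :
    interL (p :: L) M = (M.map fun q => p ∩ q) ++ interL L M := rfl

theorem interL_append (L L' M : List (Finset ℕ+)) :
    interL (L ++ L') M = interL L M ++ interL L' M :=
  List.flatMap_append

theorem clean_map_inter_clean (p : Finset ℕ+) (M : List (Finset ℕ+)) :
    clean ((clean M).map fun q => p ∩ q) = clean (M.map fun q => p ∩ q) := by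
  induction M with
  | nil => rfl
  | cons q M ih =>
    by_cases hq : q.Nonempty
    · have h : clean (q :: M) = q :: clean M := by simp [clean, hq]
      rw [h, List.map_cons, List.map_cons, ← List.singleton_append, clean_append, ih,
        ← clean_append, List.singleton_append]
    · have h : clean (q :: M) = clean M := by simp [clean, hq]
      have hq' : q = ∅ := Finset.not_nonempty_iff_eq_empty.1 hq
      rw [h, ih, hq']
      simp [clean]

theorem clean_interL_clean_right (L M : List (Finset ℕ+)) :
    clean (interL L (clean M)) = clean (interL L M) := by
  induction L with
  | nil => rfl
  | cons p L ih => rw [interL_cons, interL_cons, clean_append, clean_append, ih,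
      clean_map_inter_clean]

theorem clean_interL_clean_left (L M : List (Finset ℕ+)) :
    clean (interL (clean L) M) = clean (interL L M) := by
  induction L with
  | nil => rfl
  | cons p L ih =>
    by_cases hp : p.Nonempty
    · have h : clean (p :: L) = p :: clean L := by simp [clean, hp]
      rw [h, interL_cons, interL_cons, clean_append, clean_append, ih]
    · have h : clean (p :: L) = clean L := by simp [clean, hp]
      have hp' : p = ∅ := Finset.not_nonempty_iff_eq_empty.1 hp
      rw [h, ih, hp', interL_cons, clean_append]
      simp [clean]

theorem interL_assoc (L M N : List (Finset ℕ+)) :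
    interL (interL L M) N = interL L (interL M N) := by
  induction L with
  | nil => rfl
  | cons p L ih =>
    rw [interL_cons, interL_cons, interL_append, ih]
    congr 1
    simp [interL, List.flatMap_map, List.map_flatMap, Finset.inter_assoc, Function.comp_def]

/-- The product of two set compositions: all intersections `Pᵢ ∩ Qⱼ` in lexicographic order, with
empty sets deleted. -/
def wedge (P Q : SetComp) : SetComp where
  parts := clean (interL P.parts Q.parts)
  nonempty := by
    intro p hp
    simpa using (List.mem_filter.1 hp).2
  disjoint := by
    refine List.Pairwise.filter _ ?_
    unfold interL
    rw [List.pairwise_flatMap]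
    constructor
    · intro p _
      rw [List.pairwise_map]
      exact Q.disjoint.imp fun h =>
        h.mono Finset.inter_subset_right Finset.inter_subset_right
    · refine P.disjoint.imp fun h => ?_
      intro x hx y hy
      obtain ⟨q, -, rfl⟩ := List.mem_map.1 hx
      obtain ⟨q', -, rfl⟩ := List.mem_map.1 hy
      exact h.mono Finset.inter_subset_left Finset.inter_subset_left

namespace Comp

variable {A : Finset ℕ+}

instance : Mul (Comp A) where
  mul P Q := ⟨wedge P.val Q.val, by
    have hP : unionL P.val.parts = A := P.2
    have hQ : unionL Q.val.parts = A := Q.2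
    simp [SetComp.supp, wedge, unionL_clean, unionL_interL, hP, hQ]⟩

/-- The set composition `(A)` of `A`; it is the empty tuple if `A` is empty. -/
instance : One (Comp A) where
  one := ⟨⟨clean [A], fun p hp => by simpa using (List.mem_filter.1 hp).2,
    List.Pairwise.filter _ (List.pairwise_singleton _ _)⟩, by
    rw [SetComp.supp, unionL_clean]
    simp [unionL]⟩

theorem parts_mul (P Q : Comp A) : (P * Q).parts = clean (interL P.parts Q.parts) := rfl

theorem parts_one : (1 : Comp A).parts = clean [A] := rfl

theorem clean_parts (P : Comp A) : clean P.parts = P.parts := clean_eq_self P.val.nonempty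

theorem subset_of_mem {P : Comp A} {p : Finset ℕ+} (hp : p ∈ P.parts) : p ⊆ A := by
  intro a ha
  have h : P.val.supp = A := P.2
  rw [← h]
  exact mem_unionL.2 ⟨p, hp, ha⟩

/-- The set compositions of `A` form a monoid under the intersection product. -/
instance : Monoid (Comp A) where
  mul_assoc P Q R := by
    apply ext_parts
    rw [parts_mul, parts_mul, parts_mul, parts_mul, clean_interL_clean_left,
      clean_interL_clean_right, interL_assoc]
  one_mul P := by
    apply ext_parts
    rw [parts_mul, parts_one, clean_interL_clean_left]
    have h : interL [A] P.parts = P.parts := by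
      simp only [interL, List.flatMap_cons, List.flatMap_nil, List.append_nil]
      conv_rhs => rw [← List.map_id P.parts]
      exact List.map_congr_left fun p hp => Finset.inter_eq_right.2 (subset_of_mem hp)
    rw [h, clean_parts]
  mul_one P := by
    apply ext_parts
    rw [parts_mul, parts_one, clean_interL_clean_right]
    have h : interL P.parts [A] = P.parts := by
      simp only [interL, List.map_cons, List.map_nil]
      rw [← List.map_eq_flatMap]
      conv_rhs => rw [← List.map_id P.parts]
      exact List.map_congr_left fun p hp => Finset.inter_eq_left.2 (subset_of_mem hp)
    rw [h, clean_parts]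

end Comp

/-- The Solomon-Tits algebra of `A` over `F`: the semigroup algebra of the monoid of set
compositions of `A`. -/
abbrev Alg (F : Type*) [Field F] (A : Finset ℕ+) : Type _ := MonoidAlgebra F (Comp A)

/-! ### The concatenation product and the idempotents `e_Q` -/

/-- Concatenation of two set compositions of disjoint sets. -/
def concat (P Q : SetComp) (h : Disjoint P.supp Q.supp) : SetComp where
  parts := P.parts ++ Q.parts
  nonempty := by
    intro p hp
    rcases List.mem_append.1 hp with hp | hp
    exacts [P.nonempty p hp, Q.nonempty p hp]
  disjoint := by
    rw [List.pairwise_append]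
    refine ⟨P.disjoint, Q.disjoint, fun p hp q hq => ?_⟩
    rw [Finset.disjoint_left] at h ⊢
    exact fun a hap haq => h (mem_unionL.2 ⟨p, hp, hap⟩) (mem_unionL.2 ⟨q, hq, haq⟩)

/-- The empty set composition. -/
def emptyComp : SetComp := ⟨[], by simp, List.Pairwise.nil⟩

section Idempotents

variable (F : Type*) [Field F]

open Classical in
/-- The concatenation product on the vector space with basis all set compositions: the bilinear
extension of concatenation of set compositions of disjoint sets, all other products of basis
elements being zero. -/
def vee (f g : SetComp →₀ F) : SetComp →₀ F :=
  f.sum fun P a => g.sum fun Q b =>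
    if h : Disjoint P.supp Q.supp then Finsupp.single (concat P Q h) (a * b) else 0

open Classical in
/-- The element `e_A`, the sum of `(-1)^(ℓ(P)-1) P` over all set compositions `P` of `A` with
`min A` in the first component. -/
def eSet (A : Finset ℕ+) : SetComp →₀ F :=
  ∑ P : Comp A with P.MinInFirst, Finsupp.single P.val ((-1 : F) ^ (P.length - 1))

/-- The concatenation product `e_{Q₁} ∨ ⋯ ∨ e_{Qₖ}`. -/
def eList (L : List (Finset ℕ+)) : SetComp →₀ F :=
  L.foldr (fun X f => vee F (eSet F X) f) (Finsupp.single emptyComp 1)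

/-- `e_Q = e_{Q₁} ∨ ⋯ ∨ e_{Qₖ}`, as an element of the Solomon-Tits algebra of `A`. All set
compositions in the support of the concatenation product are compositions of `A`. -/
def e {A : Finset ℕ+} (Q : Comp A) : Alg F A :=
  ∑ P : Comp A, MonoidAlgebra.single P (eList F Q.parts P.val)

theorem eList_supp (L : List (Finset ℕ+)) (P : SetComp) (hP : eList F L P ≠ 0) :
    P.supp = unionL L := by
  classical
  induction L generalizing P with
  | nil =>
    have h : P = emptyComp := by
      by_contra hne
      exact hP (by simp [eList, Ne.symm hne])
    rw [h]
    rfl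
  | cons X L ih =>
    have h1 : eList F (X :: L) = vee F (eSet F X) (eList F L) := rfl
    rw [h1, vee] at hP
    obtain ⟨R, hR, hP⟩ := Finset.exists_ne_zero_of_sum_ne_zero
      (by simpa only [Finsupp.sum, Finsupp.finsetSum_apply] using hP)
    obtain ⟨S, hS, hP⟩ := Finset.exists_ne_zero_of_sum_ne_zero
      (by simpa only [Finsupp.sum, Finsupp.finsetSum_apply] using hP)
    have hSs := ih S (Finsupp.mem_support_iff.1 hS)
    have hRs : R.supp = X := by
      have hR' := Finsupp.mem_support_iff.1 hR
      rw [eSet, Finsupp.finsetSum_apply] at hR'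
      obtain ⟨T, -, hT⟩ := Finset.exists_ne_zero_of_sum_ne_zero hR'
      have h2 : T.val = R := by
        by_contra hne
        exact hT (by simp [hne])
      rw [← h2]
      exact T.2
    split_ifs at hP with hd
    · have h3 : concat R S hd = P := by
        by_contra hne
        exact hP (by simp [hne])
      rw [← h3]
      ext a
      have h4 : unionL (X :: L) = X ∪ unionL L := rfl
      rw [h4, ← hRs, ← hSs, Finset.mem_union]
      simp only [SetComp.supp, concat, mem_unionL, List.mem_append]
      constructor
      · rintro ⟨p, hp | hp, ha⟩
        exacts [Or.inl ⟨p, hp, ha⟩, Or.inr ⟨p, hp, ha⟩]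
      · rintro (⟨p, hp, ha⟩ | ⟨p, hp, ha⟩)
        exacts [⟨p, Or.inl hp, ha⟩, ⟨p, Or.inr hp, ha⟩]
    · simp at hP

end Idempotents

/-! ### Radicals, Loewy layers and multiplicities of modules -/

section Modules

variable (R : Type*) [Ring R] (M : Type*) [AddCommGroup M] [Module R M]
  (S : Type*) [AddCommGroup S] [Module R S]

/-- The descending Loewy series of a module: `rad^(0) M = M`, and `rad^(k+1) M` is the
radical (the intersection of all maximal submodules) of `rad^(k) M`. -/
def radSeries : ℕ → Submodule R M
  | 0 => ⊤
  | k + 1 => (Module.jacobson R (radSeries k)).map (radSeries k).subtype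

/-- The `k`-th Loewy layer `rad^(k) M / rad^(k+1) M`. -/
abbrev LoewyLayer (k : ℕ) : Type _ :=
  radSeries R M k ⧸ (radSeries R M (k + 1)).submoduleOf (radSeries R M k)

/-- `S` occurs as a direct summand in `M`. -/
def OccursAsSummand : Prop :=
  ∃ N N' : Submodule R M, IsCompl N N' ∧ Nonempty (N ≃ₗ[R] S)

/-- `S` occurs in `M` as a direct summand with multiplicity exactly `m`: `M` is the direct sum of
`m` copies of `S` and a module in which `S` does not occur as a direct summand. -/
def HasSummandMultiplicity (m : ℕ) : Prop :=
  ∃ N N' : Submodule R M, IsCompl N N' ∧ Nonempty (N ≃ₗ[R] (Fin m → S)) ∧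
    ¬ OccursAsSummand R N' S

variable {R M}

/-- The number of factors of a composition series that are isomorphic to `S`. -/
def factorCount (s : CompositionSeries (Submodule R M)) : ℕ :=
  Nat.card {i : Fin s.length //
    Nonempty ((s i.succ ⧸ (s i.castSucc).submoduleOf (s i.succ)) ≃ₗ[R] S)}

variable (R M)

open Classical in
/-- The multiplicity of `S` as a factor in a composition series of `M` from `0` to `M`
(and `0` if there is no such series). -/
def compMultiplicity : ℕ :=
  if h : ∃ s : CompositionSeries (Submodule R M), s.head = ⊥ ∧ s.last = ⊤ then
    factorCount S h.choose else 0

variable {R M}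

theorem factorCount_eq_of_equivalent {s t : CompositionSeries (Submodule R M)}
    (h : s.Equivalent t) : factorCount S s = factorCount S t := by
  obtain ⟨f, hf⟩ := h
  refine Nat.card_congr (f.subtypeEquiv fun i => ?_)
  have key : Nonempty ((s i.succ ⧸ (s i.castSucc).submoduleOf (s i.succ)) ≃ₗ[R]
      (t (f i).succ ⧸ (t (f i).castSucc).submoduleOf (t (f i).succ))) := by
    refine JordanHolderLattice.Iso.rel
      (fun x y : Submodule R M × Submodule R M =>
        Nonempty ((x.2 ⧸ x.1.submoduleOf x.2) ≃ₗ[R] (y.2 ⧸ y.1.submoduleOf y.2)))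
      ⟨LinearEquiv.refl R _⟩ (fun ⟨a⟩ => ⟨a.symm⟩) (fun ⟨a⟩ ⟨b⟩ => ⟨a.trans b⟩) ?_ (hf i)
    intro x y _
    have e1 := LinearMap.quotientInfEquivSupQuotient y x
    rw [inf_comm, sup_comm] at e1
    refine ⟨LinearEquiv.trans e1.symm (Submodule.quotEquivOfEq _ _ ?_)⟩
    ext z
    simp [Submodule.submoduleOf]
  obtain ⟨g⟩ := key
  exact ⟨fun ⟨a⟩ => ⟨g.symm.trans a⟩, fun ⟨a⟩ => ⟨g.trans a⟩⟩

/-- The multiplicity may be computed in any composition series. -/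
theorem compMultiplicity_eq (s : CompositionSeries (Submodule R M)) (h0 : s.head = ⊥)
    (h1 : s.last = ⊤) : compMultiplicity R M S = factorCount S s := by
  have h : ∃ s : CompositionSeries (Submodule R M), s.head = ⊥ ∧ s.last = ⊤ := ⟨s, h0, h1⟩
  rw [compMultiplicity, dif_pos h]
  exact factorCount_eq_of_equivalent S (CompositionSeries.jordan_holder _ _
    (h.choose_spec.1.trans h0.symm) (h.choose_spec.2.trans h1.symm))

end Modules

/-! ### The modules of the Solomon-Tits algebra -/

section Solomon

variable (F : Type*) [Field F] {A : Finset ℕ+}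

/-- The principal indecomposable left module `Λ_Q`, the left ideal generated by `e_Q`. -/
abbrev Lam (Q : Comp A) : Submodule (Alg F A) (Alg F A) := Submodule.span (Alg F A) {e F Q}

/-- The simple module `M_Q`, the quotient of `Λ_Q` by its radical. -/
abbrev Simp (Q : Comp A) : Type _ := Lam F Q ⧸ Module.jacobson (Alg F A) (Lam F Q)

/-- The Cartan invariant `C_{P,Q}`, the multiplicity of `M_P` in a composition series
of `Λ_Q`. -/
def cartan (P Q : Comp A) : ℕ := compMultiplicity (Alg F A) (Lam F Q) (Simp F P)

end Solomon

end

end SolomonTits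

-- A set composition is read as a word whose letters are finite sets. This embeds the Solomon-Tits
-- algebra in the noncommutative polynomials, and `P` acts on a word by concatenating its
-- restrictions to the components of `P`. The element `e_X` behaves like a primitive (Lie) element.
-- The tuple of restrictions to the components of `P` is multiplicative in the word and annihilates
-- `e_X` unless `X` lies in one component (`split_ePoly_eq_zero`). Polynomials with letters in
-- different components commute after this splitting. Hence a nested commutator of elements `e_q` is
-- annihilated unless all the `q` lie in one component of `P` (`split_bracket`).
--
-- Now `e_Q` is a product of elements `e_q`, and `Λ_Q` is spanned by products of nested brackets in
-- which each component of `Q` occurs once. Let `T` be the tuple of the unions of the brackets of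
-- such a product. If `T` does not refine `P`, then `P` annihilates the product; otherwise `P` only
-- reorders its factors. A commutator of two brackets is a combination of single brackets, so
-- reordering changes the product by terms with fewer brackets. On the layers of the filtration by
-- number of brackets, `P` therefore acts diagonally, with eigenvalue 1 or 0 according to whether
-- `T` refines `P`.
--
-- The filtration is the radical series. Its layers are semisimple, so the radical of each step lies
-- in the next smaller one. Conversely, a bracket `[e_x, b]` is a difference of two orderings of
-- `e_x` and `b`, so a product with fewer than `ℓ(Q)` brackets is `(P - P')` times a product with
-- one bracket more, where `P` and `P'` have the same components; such differences lower the
-- filtration, which forces the other inclusion (`le_map_jacobson_of_chain`). Thus the `k`-th Loewy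
-- layer only involves `T` coarser than `Q` with `ℓ(Q) - k` components.
--
-- Multiplicities are counted by `e_T`, an idempotent acting as 1 on vectors whose character belongs
-- to the components of `T` and as 0 on other common eigenvectors. So `C_{T,Q} = dim e_T Λ_Q`, and
-- this dimension comes from a single layer. It is positive when `Q` refines `T`: grouping the
-- components of `Q` by those of `T` gives a product of brackets that is nonzero in the free algebra
-- and is fixed by `e_T`.

namespace SolomonTits

-- Composition multiplicities as ranks of an idempotent

section EigenModules

variable {F R M : Type*} [Field F] [Ring R] [Algebra F R] [AddCommGroup M] [Module R M]
  [Module F M] [IsScalarTower F R M]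

theorem smul_scalar_comm (a : R) (c : F) (x : M) : a • c • x = c • a • x := by
  rw [← algebraMap_smul R c x, ← algebraMap_smul R c (a • x), smul_smul, smul_smul,
    Algebra.commutes]

theorem scalar_smul_mem (N : Submodule R M) (c : F) {x : M} (hx : x ∈ N) : c • x ∈ N := by
  rw [← algebraMap_smul R c x]
  exact N.smul_mem _ hx

variable (F) in
/-- The action of an element of an `F`-algebra on a module, as an `F`-linear map. -/
def actBy (t : R) (M : Type*) [AddCommGroup M] [Module R M] [Module F M]
    [IsScalarTower F R M] :
    M →ₗ[F] M where
  toFun x := t • x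
  map_add' := smul_add t
  map_smul' c x := smul_scalar_comm t c x

@[simp] theorem actBy_apply (t : R) (x : M) : actBy F t M x = t • x := rfl

variable (F) in
/-- The dimension of `t M`. -/
noncomputable def rankOn (t : R) (M : Type*) [AddCommGroup M] [Module R M] [Module F M] [IsScalarTower F R M] :
    ℕ :=
  Module.finrank F (LinearMap.range (actBy F t M))

theorem rankOn_congr {M' : Type*} [AddCommGroup M'] [Module R M'] [Module F M']
    [IsScalarTower F R M'] (t : R) (g : M ≃ₗ[R] M') : rankOn F t M = rankOn F t M' := by
  have hg : ∀ (c : F) (x : M), g (c • x) = c • g x := fun c x => by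
    rw [← algebraMap_smul R c x, map_smul, algebraMap_smul]
  let g' : M ≃ₗ[F] M' := { g with map_smul' := hg }
  have h : (LinearMap.range (actBy F t M)).map g'.toLinearMap =
      LinearMap.range (actBy F t M') := by
    ext y
    constructor
    · rintro ⟨_, ⟨x, rfl⟩, rfl⟩
      exact ⟨g x, (g.map_smul t x).symm⟩
    · rintro ⟨x, rfl⟩
      refine ⟨t • g.symm x, ⟨g.symm x, rfl⟩, ?_⟩
      change g (t • g.symm x) = t • x
      simp
  rw [rankOn, rankOn, ← h]
  exact (LinearEquiv.finrank_map_eq g' _).symm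

/-- Idempotence makes `M ↦ tM` exact: an element `tx` of `N` equals `t(tx)`, so the kernel of `tM →
t(M/N)` is `tN`. -/
theorem rankOn_eq_add {t : R} (ht : IsIdempotentElem t) [FiniteDimensional F M]
    (N : Submodule R M) : rankOn F t M = rankOn F t N + rankOn F t (M ⧸ N) := by
  let q : M →ₗ[F] M ⧸ N := N.mkQ.restrictScalars F
  let i : N →ₗ[F] M := N.subtype.restrictScalars F
  let f : LinearMap.range (actBy F t M) →ₗ[F] M ⧸ N :=
    q.domRestrict (LinearMap.range (actBy F t M))
  have hr : LinearMap.range f = LinearMap.range (actBy F t (M ⧸ N)) := by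
    ext y
    constructor
    · rintro ⟨⟨_, x, rfl⟩, rfl⟩
      exact ⟨N.mkQ x, (N.mkQ.map_smul t x).symm⟩
    · rintro ⟨x, rfl⟩
      obtain ⟨x, rfl⟩ := N.mkQ_surjective x
      exact ⟨⟨t • x, x, rfl⟩, N.mkQ.map_smul t x⟩
  have hk : (LinearMap.ker f).map (LinearMap.range (actBy F t M)).subtype =
      (LinearMap.range (actBy F t N)).map i := by
    ext y
    constructor
    · rintro ⟨⟨_, x, rfl⟩, hx, rfl⟩
      have hx' : N.mkQ (t • x) = 0 := hx
      rw [Submodule.mkQ_apply, Submodule.Quotient.mk_eq_zero] at hx'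
      refine ⟨⟨t • x, hx'⟩, ⟨⟨t • x, hx'⟩, ?_⟩, rfl⟩
      ext
      simp [smul_smul, ht.eq]
    · rintro ⟨_, ⟨x, rfl⟩, rfl⟩
      refine ⟨⟨t • (x : M), x, rfl⟩, ?_, rfl⟩
      change N.mkQ (t • (x : M)) = 0
      rw [Submodule.mkQ_apply, Submodule.Quotient.mk_eq_zero]
      exact N.smul_mem _ x.2
  have hi : Function.Injective i := N.injective_subtype
  have h1 := LinearMap.finrank_range_add_finrank_ker f
  rw [← Submodule.finrank_map_subtype_eq, hk, hr] at h1
  have h2 : Module.finrank F ((LinearMap.range (actBy F t N)).map i) = rankOn F t N :=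
    (Submodule.equivMapOfInjective i hi _).finrank_eq.symm
  rw [rankOn, ← h1, h2, add_comm]
  rfl

theorem rankOn_eq_zero_iff {t : R} [FiniteDimensional F M] :
    rankOn F t M = 0 ↔ ∀ x : M, t • x = 0 := by
  rw [rankOn, Submodule.finrank_eq_zero, LinearMap.range_eq_bot]
  exact ⟨fun h x => LinearMap.congr_fun h x, fun h => LinearMap.ext h⟩

theorem rankOn_submodule_eq_add {t : R} (ht : IsIdempotentElem t) [FiniteDimensional F M]
    {N N' : Submodule R M} (h : N ≤ N') :
    rankOn F t N' = rankOn F t N + rankOn F t (N' ⧸ N.submoduleOf N') := by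
  have : FiniteDimensional F N' :=
    inferInstanceAs (FiniteDimensional F (N'.restrictScalars F))
  rw [rankOn_eq_add ht (N.submoduleOf N'),
    rankOn_congr t (Submodule.submoduleOfEquivOfLe h)]

/-- The map `a ↦ a x` on `Rt` is nonzero, hence onto `X`. Its kernel is maximal and contains the
radical of `Rt`, which is itself maximal, so the two agree. -/
theorem nonempty_equiv_of_smul_ne_zero {t : R}
    [IsSimpleModule R (Submodule.span R {t} ⧸ Module.jacobson R (Submodule.span R {t}))]
    {X : Type*} [AddCommGroup X] [Module R X] [IsSimpleModule R X] {x : X} (hx : t • x ≠ 0) :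
    Nonempty (X ≃ₗ[R] (Submodule.span R {t} ⧸ Module.jacobson R (Submodule.span R {t}))) := by
  let f : Submodule.span R {t} →ₗ[R] X :=
    (LinearMap.toSpanSingleton R X x).domRestrict (Submodule.span R {t})
  have hf : f ≠ 0 := fun h =>
    hx (LinearMap.congr_fun h ⟨t, Submodule.mem_span_singleton_self t⟩)
  have hs := LinearMap.surjective_of_ne_zero hf
  have hc : IsCoatom (LinearMap.ker f) := LinearMap.isCoatom_ker_of_surjective hs
  have hj : IsCoatom (Module.jacobson R (Submodule.span R {t})) :=
    isSimpleModule_iff_isCoatom.1 inferInstance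
  have hle : Module.jacobson R (Submodule.span R {t}) ≤ LinearMap.ker f := sInf_le hc
  have heq : LinearMap.ker f = Module.jacobson R (Submodule.span R {t}) :=
    ((hj.le_iff.1 hle).resolve_left hc.1)
  exact ⟨(f.quotKerEquivOfSurjective hs).symm.trans (Submodule.quotEquivOfEq _ _ heq)⟩

theorem eq_add_sum_of_succ {n : ℕ} (f : Fin (n + 1) → ℕ) (g : Fin n → ℕ)
    (h : ∀ i : Fin n, f i.succ = f i.castSucc + g i) : f (Fin.last n) = f 0 + ∑ i, g i := by
  induction n with
  | zero => simp
  | succ n ih =>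
    rw [Fin.sum_univ_castSucc, ← add_assoc, ← Fin.succ_last, h]
    congr 1
    exact ih (fun i => f i.castSucc) (fun i => g i.castSucc) fun i => by
      simpa using h i.castSucc

/-- The rank of `t` adds up along a composition series. A factor isomorphic to the head of `Rt`
contributes 1, and `nonempty_equiv_of_smul_ne_zero` shows that `t` annihilates every other factor.
-/
theorem compMultiplicity_eq_rankOn {t : R} (ht : IsIdempotentElem t)
    [IsSimpleModule R (Submodule.span R {t} ⧸ Module.jacobson R (Submodule.span R {t}))]
    (h1 : rankOn F t (Submodule.span R {t} ⧸ Module.jacobson R (Submodule.span R {t})) = 1)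
    [FiniteDimensional F M] :
    compMultiplicity R M (Submodule.span R {t} ⧸ Module.jacobson R (Submodule.span R {t})) =
      rankOn F t M := by
  classical
  have : IsNoetherian R M := isNoetherian_of_tower F inferInstance
  have : IsArtinian R M := isArtinian_of_tower F inferInstance
  obtain ⟨s, hs0, hs1⟩ := exists_compositionSeries_of_isNoetherian_isArtinian R M
  rw [compMultiplicity_eq _ s hs0 hs1, factorCount, Nat.card_eq_fintype_card,
    Fintype.card_subtype, Finset.card_filter]
  have key := eq_add_sum_of_succ (fun i => rankOn F t (s i)) (fun i : Fin s.length => if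
    Nonempty ((s i.succ ⧸ (s i.castSucc).submoduleOf (s i.succ)) ≃ₗ[R]
      (Submodule.span R {t} ⧸ Module.jacobson R (Submodule.span R {t}))) then 1 else 0) ?_
  · have hbot : rankOn F t (s 0) = 0 := by
      have h0 : s 0 = ⊥ := hs0
      rw [h0]
      exact Module.finrank_zero_of_subsingleton
    have htop : rankOn F t (s (Fin.last s.length)) = rankOn F t M := by
      have h0 : s (Fin.last s.length) = ⊤ := hs1
      rw [h0]
      exact rankOn_congr t Submodule.topEquiv
    simp only [hbot, htop, zero_add] at key
    exact key.symm
  · intro i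
    have hcov := s.step i
    have hle : s i.castSucc ≤ s i.succ := hcov.le
    have : IsSimpleModule R (s i.succ ⧸ (s i.castSucc).submoduleOf (s i.succ)) :=
      (covBy_iff_quot_is_simple hle).1 hcov
    have : FiniteDimensional F (s i.succ) :=
      inferInstanceAs (FiniteDimensional F ((s i.succ).restrictScalars F))
    rw [rankOn_submodule_eq_add ht hle]
    congr 1
    split_ifs with h
    · rw [rankOn_congr t h.some, h1]
    · rw [rankOn_eq_zero_iff]
      intro x
      by_contra hx
      exact h (nonempty_equiv_of_smul_ne_zero hx)

-- Modules spanned by common eigenvectors, and their radicals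

variable (F) in
-- For an eigenvector `x`, a nonzero submodule of `Rx` contains a nonzero scalar multiple of `x`,
-- hence `x`. So `M` is a sum of simple or zero modules.
theorem isSemisimpleModule_of_span_eigen {X : Set M}
    (hX : ∀ x ∈ X, ∀ a : R, ∃ c : F, a • x = c • x) (hspan : Submodule.span R X = ⊤) :
    IsSemisimpleModule R M := by
  refine isSemisimpleModule_of_isSemisimpleModule_submodule'
    (p := fun x : X => Submodule.span R {(x : M)}) ?_ ?_
  · rintro ⟨x, hx⟩
    by_cases hx0 : x = 0
    · subst hx0
      have : Subsingleton (Submodule.span R {(0 : M)}) := by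
        rw [Submodule.span_zero_singleton]
        infer_instance
      exact { exists_isCompl := fun a => ⟨a, disjoint_iff.2 (Subsingleton.elim _ _),
        codisjoint_iff.2 (Subsingleton.elim _ _)⟩ }
    · have : IsSimpleModule R (Submodule.span R {x}) := by
        rw [isSimpleModule_iff_isAtom]
        refine ⟨by simpa using hx0, fun N hN => ?_⟩
        by_contra hne
        obtain ⟨y, hy, hy0⟩ := N.exists_mem_ne_zero_of_ne_bot hne
        obtain ⟨a, rfl⟩ := Submodule.mem_span_singleton.1 (hN.le hy)
        obtain ⟨c, hc⟩ := hX x hx a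
        rw [hc] at hy hy0
        have hc0 : c ≠ 0 := fun h => hy0 (by rw [h, zero_smul])
        have := scalar_smul_mem N c⁻¹ hy
        rw [smul_smul, inv_mul_cancel₀ hc0, one_smul] at this
        exact hN.not_ge ((Submodule.span_singleton_le_iff_mem _ _).2 this)
      infer_instance
  · rw [← hspan, Submodule.span_eq_iSup_of_singleton_spans, iSup_subtype]

/-- If `t` is an idempotent that acts on `M` with image consisting of eigenvectors with character
`χ` and commutes with the action of `R`, then `t M` is the isotypic part of `M` that belongs to the
one-dimensional module with character `χ`. -/
theorem hasSummandMultiplicity_rankOn {S : Type*} [AddCommGroup S] [Module R S] [Module F S]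
    [IsScalarTower F R S] {t : R} (ht : IsIdempotentElem t) (χ : R → F) (hχ : χ t = 1)
    (hS : Module.finrank F S = 1) (hSχ : ∀ (a : R) (s : S), a • s = χ a • s)
    [FiniteDimensional F M] (hM : ∀ (a : R) (x : M), a • t • x = χ a • t • x)
    (hc : ∀ (a : R) (x : M), t • a • x = a • t • x) :
    HasSummandMultiplicity R M S (rankOn F t M) := by
  let τ : M →ₗ[R] M :=
    { toFun := fun x => t • x
      map_add' := smul_add t
      map_smul' := fun a x => hc a x }
  have hτ : IsIdempotentElem τ := by
    ext x
    change t • t • x = t • x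
    rw [smul_smul, ht.eq]
  refine ⟨LinearMap.range τ, LinearMap.ker τ, LinearMap.IsIdempotentElem.isCompl hτ, ?_, ?_⟩
  · have : FiniteDimensional F S := Module.finite_of_finrank_pos (by omega)
    have hb : Nonempty (S ≃ₗ[F] F) :=
      ⟨LinearEquiv.ofFinrankEq _ _ (by rw [hS, Module.finrank_self])⟩
    obtain ⟨g⟩ := hb
    have : FiniteDimensional F (LinearMap.range τ) :=
      inferInstanceAs (FiniteDimensional F ((LinearMap.range τ).restrictScalars F))
    have hd : Module.finrank F (LinearMap.range τ) = rankOn F t M := by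
      rw [rankOn]
      exact congrArg (fun N : Submodule F M => Module.finrank F N)
        (show (LinearMap.range τ).restrictScalars F = LinearMap.range (actBy F t M) from rfl)
    let b := Module.finBasisOfFinrankEq F (LinearMap.range τ) hd
    let k : LinearMap.range τ ≃ₗ[F] (Fin (rankOn F t M) → S) :=
      b.equivFun.trans (LinearEquiv.piCongrRight fun _ => g.symm)
    refine ⟨{ k with map_smul' := fun a x => ?_ }⟩
    change k (a • x) = a • k x
    have h1 : a • x = χ a • x := by
      obtain ⟨_, y, rfl⟩ := x
      exact Subtype.ext (hM a y)
    have h2 : a • k x = χ a • k x := funext fun i => hSχ a (k x i)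
    rw [h1, h2, map_smul]
  -- A copy of `S` inside the kernel would be fixed by `t`, since `χ t = 1`, and also annihilated by
  -- it.
  · rintro ⟨K, K', -, ⟨g⟩⟩
    have : Nontrivial S := Module.nontrivial_of_finrank_pos (R := F) (by omega)
    obtain ⟨s, hs⟩ := exists_ne (0 : S)
    have h1 : t • g.symm s = g.symm s := by rw [← map_smul, hSχ, hχ, one_smul]
    have h2 : t • g.symm s = 0 := by
      ext
      exact (g.symm s : LinearMap.ker τ).2
    exact hs (by simpa using h1.symm.trans h2)

omit [IsScalarTower F R M] in
-- As `χ t = 1`, `t` fixes every copy of `S`. Conversely a nonzero `t x` and a nonzero `s` in `S`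
-- have the same annihilator, the zeros of `χ`, so they generate isomorphic cyclic modules;
-- semisimplicity supplies the complement.
theorem occursAsSummand_iff_exists_smul_ne_zero {S : Type*} [AddCommGroup S] [Module R S]
    [Module F S] [IsScalarTower F R S] {t : R} (χ : R → F) (hχ : χ t = 1)
    (hS : Module.finrank F S = 1) (hSχ : ∀ (a : R) (s : S), a • s = χ a • s)
    [IsSemisimpleModule R M] (hM : ∀ (a : R) (x : M), a • t • x = χ a • t • x) :
    OccursAsSummand R M S ↔ ∃ x : M, t • x ≠ 0 := by
  have : Nontrivial S := Module.nontrivial_of_finrank_pos (R := F) (by omega)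
  obtain ⟨s, hs⟩ := exists_ne (0 : S)
  constructor
  · rintro ⟨K, K', -, ⟨g⟩⟩
    have h1 : t • g.symm s = g.symm s := by rw [← map_smul, hSχ, hχ, one_smul]
    refine ⟨g.symm s, fun h => hs ?_⟩
    have h3 : g.symm s = 0 := by
      rw [← h1]
      exact Subtype.ext h
    simpa using h3
  · rintro ⟨x, hx⟩
    obtain ⟨N', hN'⟩ := exists_isCompl (Submodule.span R {t • x})
    refine ⟨_, N', hN', ?_⟩
    let f := LinearMap.toSpanSingleton R M (t • x)
    let g := LinearMap.toSpanSingleton R S s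
    have hfg : LinearMap.ker f = LinearMap.ker g := by
      ext a
      simp only [f, g, LinearMap.mem_ker, LinearMap.toSpanSingleton_apply, hM, hSχ]
      simp [hx, hs]
    have hg : Function.Surjective g := by
      intro y
      obtain ⟨c, rfl⟩ := (finrank_eq_one_iff_of_nonzero' s hs).1 hS y
      exact ⟨algebraMap F R c, by simp [g]⟩
    have hf : LinearMap.range f = Submodule.span R {t • x} := LinearMap.range_toSpanSingleton _
    exact ⟨(LinearEquiv.ofEq _ _ hf).symm.trans (f.quotKerEquivRange.symm.trans
      ((Submodule.quotEquivOfEq _ _ hfg).trans (g.quotKerEquivOfSurjective hg)))⟩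

/-- If a chain `W` of submodules starting at `0` satisfies `W i = D (W (i + 1))`, then `W i` lies in
the radical of `W (i + 1)`. -/
theorem le_map_jacobson_of_chain (D : Set R) (W : ℕ → Submodule R M) (h0 : W 0 = ⊥)
    (hmono : Monotone W) (hD : ∀ i, ∀ d ∈ D, ∀ x ∈ W (i + 1), d • x ∈ W i) (n : ℕ)
    (hspan : W n ≤ Submodule.span R {y | ∃ d ∈ D, ∃ x ∈ W (n + 1), y = d • x}) :
    W n ≤ (Module.jacobson R (W (n + 1))).map (W (n + 1)).subtype := by
  intro w hw
  refine ⟨⟨w, hmono n.le_succ hw⟩, ?_, rfl⟩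
  simp only [SetLike.mem_coe, Module.jacobson, Submodule.mem_sInf, Set.mem_ofPred_eq]
  intro N hN
  have key : ∀ m ≤ n, W m ≤ N.map (W (n + 1)).subtype := by
    intro m
    induction m with
    | zero =>
      intro _
      rw [h0]
      exact bot_le
    | succ m ih =>
      intro hm
      by_contra hcon
      have hle : W (m + 1) ≤ W (n + 1) := hmono (by omega)
      -- If `W (m + 1)` were not inside the maximal submodule `N`, the two would sum to `W (n + 1)`.
      -- Applying `D` gives `D W (n + 1) ⊆ N + W m = N`, whence `W (m + 1) ⊆ W n ⊆ N` after all.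
      have htop : N ⊔ (W (m + 1)).submoduleOf (W (n + 1)) = ⊤ := by
        refine hN.2 _ (lt_of_le_of_ne le_sup_left fun h => hcon fun x hx => ?_)
        refine ⟨⟨x, hle hx⟩, ?_, rfl⟩
        rw [SetLike.mem_coe, h]
        exact Submodule.mem_sup_right hx
      refine hcon ((hmono hm).trans (hspan.trans (Submodule.span_le.2 ?_)))
      rintro _ ⟨d, hd, x, hx, rfl⟩
      have hx' : (⟨x, hx⟩ : W (n + 1)) ∈ N ⊔ (W (m + 1)).submoduleOf (W (n + 1)) := by
        rw [htop]
        trivial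
      obtain ⟨y, hy, z, hz, hyz⟩ := Submodule.mem_sup.1 hx'
      have hxyz : x = (y : M) + z := congrArg Subtype.val hyz.symm
      rw [SetLike.mem_coe, hxyz, smul_add]
      exact add_mem ⟨d • y, N.smul_mem d hy, rfl⟩ (ih (by omega) (hD m d hd z hz))
  obtain ⟨x, hx, hxw⟩ := key n le_rfl hw
  have hxe : x = ⟨w, hmono n.le_succ hw⟩ := Subtype.ext hxw
  rwa [← hxe]

theorem map_jacobson_le_of_isSemisimpleModule {N N' : Submodule R M}
    [IsSemisimpleModule R (N' ⧸ N.submoduleOf N')] :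
    (Module.jacobson R N').map N'.subtype ≤ N := by
  rintro _ ⟨x, hx, rfl⟩
  exact Module.jacobson_le_of_eq_bot (N := N.submoduleOf N')
    (IsSemisimpleModule.jacobson_eq_bot R _) hx

end EigenModules

end SolomonTits


namespace SolomonTits

noncomputable section

/-! ### Words in finite sets -/

/-- Words whose letters are finite sets. -/
abbrev Word := FreeMonoid (Finset ℕ+)

/-- The word `Z`, or the empty word if `Z` is empty. -/
def letter (Z : Finset ℕ+) : Word := if Z.Nonempty then FreeMonoid.of Z else 1

theorem letter_empty : letter ∅ = 1 := if_neg (by simp)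

theorem letter_of_nonempty {Z : Finset ℕ+} (h : Z.Nonempty) : letter Z = FreeMonoid.of Z := if_pos h

/-- Intersection of the letters of a word with `p`. -/
def restr (p : Finset ℕ+) : Word →* Word := FreeMonoid.lift fun r => letter (p ∩ r)

@[simp] theorem restr_of (p r : Finset ℕ+) : restr p (FreeMonoid.of r) = letter (p ∩ r) :=
  FreeMonoid.lift_eval_of _ _

theorem restr_letter (p r : Finset ℕ+) : restr p (letter r) = letter (p ∩ r) := by
  by_cases h : r.Nonempty
  · rw [letter_of_nonempty h, restr_of]
  · rw [Finset.not_nonempty_iff_eq_empty.1 h, Finset.inter_empty, letter_empty, map_one]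

theorem restr_eq_self {p : Finset ℕ+} {w : Word}
    (h : ∀ z ∈ w.toList, z.Nonempty ∧ z ⊆ p) : restr p w = w := by
  induction w using FreeMonoid.inductionOn' with
  | one => simp
  | of_mul z w ih =>
    simp only [FreeMonoid.toList_of_mul, List.mem_cons, forall_eq_or_imp] at h
    rw [map_mul, ih h.2, restr_of, Finset.inter_eq_right.2 h.1.2, letter_of_nonempty h.1.1]

theorem restr_eq_one {p : Finset ℕ+} {w : Word}
    (h : ∀ z ∈ w.toList, Disjoint p z) : restr p w = 1 := by
  induction w using FreeMonoid.inductionOn' with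
  | one => simp
  | of_mul z w ih =>
    simp only [FreeMonoid.toList_of_mul, List.mem_cons, forall_eq_or_imp] at h
    rw [map_mul, ih h.2, restr_of, Finset.disjoint_iff_inter_eq_empty.1 h.1, letter_empty, one_mul]

theorem ofList_clean_map_inter (p : Finset ℕ+) (M : List (Finset ℕ+)) :
    FreeMonoid.ofList (clean (M.map fun q => p ∩ q)) = restr p (FreeMonoid.ofList M) := by
  induction M with
  | nil => simp [clean]
  | cons q M ih =>
    rw [FreeMonoid.ofList_cons, map_mul, ← ih, restr_of, List.map_cons, ← List.singleton_append,
      clean_append, FreeMonoid.ofList_append]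
    congr 1
    by_cases h : (p ∩ q).Nonempty
    · simp [letter_of_nonempty h, clean, h]
    · simp [Finset.not_nonempty_iff_eq_empty.1 h, letter_empty, clean]

/-- Deletion of empty sets is absorbed by `letter ∅ = 1`, which turns the intersection product into
a product of monoid homomorphisms evaluated at one word. -/
theorem ofList_clean_interL (L M : List (Finset ℕ+)) :
    FreeMonoid.ofList (clean (interL L M)) =
      (L.map fun p => restr p (FreeMonoid.ofList M)).prod := by
  induction L with
  | nil => simp [clean, interL]
  | cons p L ih =>
    rw [interL_cons, clean_append, FreeMonoid.ofList_append, ih, ofList_clean_map_inter]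
    simp

variable (F : Type*) [Field F]

/-- The algebra of noncommutative polynomials in finite sets. -/
abbrev WAlg := MonoidAlgebra F Word

/-- The linear extension of the operation that intersects the components of `L` with the letters
of a word. -/
def act (L : List (Finset ℕ+)) : WAlg F →ₗ[F] WAlg F :=
  MonoidAlgebra.mapDomainLinearMap F F fun w => (L.map fun p => restr p w).prod

variable {F}

@[simp] theorem act_single (L : List (Finset ℕ+)) (w : Word) (c : F) :
    act F L (MonoidAlgebra.single w c) =
      MonoidAlgebra.single (L.map fun p => restr p w).prod c :=
  MonoidAlgebra.mapDomainLinearMap_single ..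

open Classical in
/-- The tuple of the restrictions of a word to the components of `L`. -/
def restrTuple (L : List (Finset ℕ+)) : Word →* (Finset ℕ+ → Word) :=
  MonoidHom.pi fun p => if p ∈ L then restr p else 1

variable (F) in
/-- The linear extension of `restrTuple`. -/
def split (L : List (Finset ℕ+)) : WAlg F →ₐ[F] MonoidAlgebra F (Finset ℕ+ → Word) :=
  MonoidAlgebra.mapDomainAlgHom F F (restrTuple L)

@[simp] theorem split_single (L : List (Finset ℕ+)) (w : Word) (c : F) :
    split F L (MonoidAlgebra.single w c) = MonoidAlgebra.single (restrTuple L w) c := by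
  simp [split]

/-- Concatenating the restrictions is not multiplicative in the word, but forming their tuple is.
Since `act` factors through `split`, vanishing can be tested with an algebra homomorphism. -/
theorem act_eq_zero_of_split_eq_zero {L : List (Finset ℕ+)} {x : WAlg F} (h : split F L x = 0) :
    act F L x = 0 := by
  have key : act F L = (MonoidAlgebra.mapDomainLinearMap F F
      fun g : Finset ℕ+ → Word => (L.map g).prod) ∘ₗ (split F L).toLinearMap := by
    ext w
    simp only [LinearMap.comp_apply, MonoidAlgebra.lsingle_apply, act_single,
      AlgHom.toLinearMap_apply, split_single, MonoidAlgebra.mapDomainLinearMap_single]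
    congr 2
    rw [List.map_congr_left fun p hp => ?_]
    simp [restrTuple, hp]
  rw [key, LinearMap.comp_apply, AlgHom.toLinearMap_apply, h, map_zero]

/-! ### The alternating sum over all set compositions -/

theorem sum_comp_empty {B : Type*} [AddCommMonoid B] (f : List (Finset ℕ+) → B) :
    ∑ P : Comp ∅, f P.parts = f [] := by
  have h : ∀ P : Comp ∅, P.parts = [] := by
    intro P
    by_contra hne
    obtain ⟨p, hp⟩ := List.exists_mem_of_ne_nil _ hne
    obtain ⟨a, ha⟩ := P.val.nonempty p hp
    exact absurd (Comp.subset_of_mem hp ha) (Finset.notMem_empty a)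
  rw [Fintype.sum_eq_single (1 : Comp ∅) fun P hP =>
    absurd (Comp.ext_parts ((h P).trans (h 1).symm)) hP, h]

theorem sum_comp {B : Type*} [AddCommMonoid B] {X : Finset ℕ+} (hX : X.Nonempty)
    (f : List (Finset ℕ+) → B) :
    ∑ P : Comp X, f P.parts =
      ∑ Z ∈ X.powerset with Z.Nonempty, ∑ P : Comp (X \ Z), f (Z :: P.parts) := by
  rw [Finset.sum_sigma']
  symm
  refine Finset.sum_bij (fun x hx => ⟨⟨x.1 :: x.2.parts, ?_, ?_⟩, ?_⟩) ?_ ?_ ?_ ?_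
  · intro p hp
    rcases List.mem_cons.1 hp with rfl | hp
    · exact (Finset.mem_filter.1 (Finset.mem_sigma.1 hx).1).2
    · exact x.2.val.nonempty p hp
  · refine List.pairwise_cons.2 ⟨fun p hp => ?_, x.2.val.disjoint⟩
    exact Finset.disjoint_of_subset_right (Comp.subset_of_mem hp) Finset.disjoint_sdiff
  · have h1 : unionL x.2.parts = X \ x.1 := x.2.2
    have h2 := Finset.mem_powerset.1 (Finset.mem_filter.1 (Finset.mem_sigma.1 hx).1).1
    change x.1 ∪ unionL x.2.parts = X
    rw [h1, Finset.union_sdiff_of_subset h2]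
  · intro x hx
    exact Finset.mem_univ _
  · rintro ⟨Z, P⟩ hx ⟨Z', P'⟩ hx' h
    have h' : Z :: P.parts = Z' :: P'.parts := congrArg Comp.parts h
    obtain ⟨rfl, h2⟩ := List.cons_eq_cons.1 h'
    rw [Comp.ext_parts h2]
  · intro P _
    have hP : unionL P.parts = X := P.2
    have hd : P.parts.Pairwise Disjoint := P.val.disjoint
    have hn : ∀ p ∈ P.parts, p.Nonempty := P.val.nonempty
    rcases hL : P.parts with _ | ⟨Z, l⟩
    · rw [hL] at hP
      exact absurd hP.symm hX.ne_empty
    · rw [hL] at hP hd hn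
      have hP' : Z ∪ unionL l = X := hP
      have hdl : Disjoint Z (unionL l) := by
        rw [Finset.disjoint_left]
        intro a ha hal
        obtain ⟨q, hq, haq⟩ := mem_unionL.1 hal
        exact Finset.disjoint_left.1 ((List.pairwise_cons.1 hd).1 q hq) ha haq
      have hl : unionL l = X \ Z := by
        rw [← hP', Finset.union_sdiff_left, Finset.sdiff_eq_self_of_disjoint hdl.symm]
      refine ⟨⟨Z, ⟨⟨l, fun p hp => hn p (List.mem_cons_of_mem _ hp),
        (List.pairwise_cons.1 hd).2⟩, hl⟩⟩, ?_, Comp.ext_parts hL.symm⟩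
      simp only [Finset.mem_sigma, Finset.mem_filter, Finset.mem_powerset]
      exact ⟨⟨hP' ▸ Finset.subset_union_left, hn Z List.mem_cons_self⟩, Finset.mem_univ _⟩
  · intro x hx
    rfl

variable (F) in
/-- The word `Z`, or `1` if `Z` is empty. -/
def nu (Z : Finset ℕ+) : WAlg F := MonoidAlgebra.single (letter Z) 1

variable (F) in
/-- The sum of `(-1)^ℓ(P) P` over all set compositions `P` of `X`. -/
def altSum (X : Finset ℕ+) : WAlg F :=
  ∑ P : Comp X, MonoidAlgebra.single (FreeMonoid.ofList P.parts) ((-1) ^ P.parts.length)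

theorem nu_empty : nu F ∅ = 1 := by rw [nu, letter_empty]; rfl

theorem altSum_empty : altSum F ∅ = 1 := by
  rw [altSum, sum_comp_empty fun L => MonoidAlgebra.single (FreeMonoid.ofList L)
    ((-1 : F) ^ L.length)]
  simp [MonoidAlgebra.one_def]

theorem nu_mul_altSum {Z : Finset ℕ+} (hZ : Z.Nonempty) (Y : Finset ℕ+) :
    nu F Z * altSum F Y = ∑ P : Comp Y, MonoidAlgebra.single (FreeMonoid.ofList (Z :: P.parts))
      ((-1) ^ P.parts.length) := by
  rw [altSum, Finset.mul_sum]
  refine Finset.sum_congr rfl fun P _ => ?_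
  rw [nu, MonoidAlgebra.single_mul_single, letter_of_nonempty hZ, one_mul]
  rfl

theorem altSum_eq {X : Finset ℕ+} (hX : X.Nonempty) :
    altSum F X = - ∑ Z ∈ X.powerset with Z.Nonempty, nu F Z * altSum F (X \ Z) := by
  rw [altSum, sum_comp hX fun L => MonoidAlgebra.single (FreeMonoid.ofList L)
    ((-1 : F) ^ L.length), ← Finset.sum_neg_distrib]
  refine Finset.sum_congr rfl fun Z hZ => ?_
  rw [nu_mul_altSum (Finset.mem_filter.1 hZ).2, ← Finset.sum_neg_distrib]
  refine Finset.sum_congr rfl fun P _ => ?_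
  rw [List.length_cons, pow_succ, mul_neg_one, ← MonoidAlgebra.single_neg]

theorem filter_nonempty_not_powerset (X : Finset ℕ+) :
    {Z ∈ X.powerset | ¬ Z.Nonempty} = {∅} := by
  ext Z
  simp only [Finset.mem_filter, Finset.mem_powerset, Finset.not_nonempty_iff_eq_empty,
    Finset.mem_singleton]
  exact ⟨fun h => h.2, fun h => ⟨h ▸ Finset.empty_subset X, h⟩⟩

/-- For convolution over subsets, `altSum` is inverse to `nu`: the term `Z = ∅` is cancelled by the
others, which sort the compositions of `X` by first component. -/
theorem sum_nu_mul_altSum (X : Finset ℕ+) :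
    ∑ Z ∈ X.powerset, nu F Z * altSum F (X \ Z) = if X = ∅ then 1 else 0 := by
  rw [← Finset.sum_filter_add_sum_filter_not _ Finset.Nonempty, filter_nonempty_not_powerset,
    Finset.sum_singleton, nu_empty, one_mul, Finset.sdiff_empty]
  rcases X.eq_empty_or_nonempty with rfl | hX
  · rw [if_pos rfl, altSum_empty, Finset.powerset_empty]
    refine add_eq_right.2 (Finset.sum_eq_zero fun Z hZ => ?_)
    obtain ⟨h, h'⟩ := Finset.mem_filter.1 hZ
    rw [Finset.mem_singleton.1 h] at h'
    exact absurd h' Finset.not_nonempty_empty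
  · rw [if_neg hX.ne_empty, altSum_eq hX, add_neg_cancel]

/-- Left cancellation for the convolution: since `f ∅ = 1`, the term `Z = ∅` isolates `S X`, and the
others involve proper subsets of `X` only. -/
theorem eq_of_sum_powerset_mul_eq {B : Type*} [Ring B] {f S S' : Finset ℕ+ → B} (hf : f ∅ = 1)
    (h : ∀ X, ∑ Z ∈ X.powerset, f Z * S (X \ Z) = ∑ Z ∈ X.powerset, f Z * S' (X \ Z)) :
    S = S' := by
  ext X
  induction X using Finset.strongInduction with
  | H X ih =>
    have h1 := h X
    rw [← Finset.sum_filter_add_sum_filter_not _ Finset.Nonempty, filter_nonempty_not_powerset,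
      ← Finset.sum_filter_add_sum_filter_not X.powerset Finset.Nonempty,
      filter_nonempty_not_powerset, Finset.sum_singleton, Finset.sum_singleton, hf, one_mul,
      one_mul, Finset.sdiff_empty] at h1
    have h2 : ∑ Z ∈ X.powerset with Z.Nonempty, f Z * S (X \ Z) =
        ∑ Z ∈ X.powerset with Z.Nonempty, f Z * S' (X \ Z) := by
      refine Finset.sum_congr rfl fun Z hZ => ?_
      obtain ⟨hZ, hZn⟩ := Finset.mem_filter.1 hZ
      rw [ih _ (Finset.sdiff_ssubset (Finset.mem_powerset.1 hZ) hZn)]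
    rw [h2] at h1
    exact add_left_cancel h1

theorem sum_powerset_inter_sdiff {B : Type*} [AddCommMonoid B] (X p : Finset ℕ+)
    (h : Finset ℕ+ → Finset ℕ+ → B) :
    ∑ Z ∈ X.powerset, h (Z ∩ p) (Z \ p) =
      ∑ Y ∈ (X ∩ p).powerset, ∑ Y' ∈ (X \ p).powerset, h Y Y' := by
  rw [← Finset.sum_product']
  refine Finset.sum_bij' (fun Z _ => (Z ∩ p, Z \ p)) (fun Y _ => Y.1 ∪ Y.2) ?_ ?_ ?_ ?_ ?_
  · intro Z hZ
    rw [Finset.mem_powerset] at hZ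
    simp only [Finset.mem_product, Finset.mem_powerset]
    exact ⟨Finset.inter_subset_inter_right hZ, Finset.sdiff_subset_sdiff hZ le_rfl⟩
  · rintro ⟨Y, Y'⟩ hY
    simp only [Finset.mem_product, Finset.mem_powerset] at hY ⊢
    exact Finset.union_subset (hY.1.trans Finset.inter_subset_left)
      (hY.2.trans Finset.sdiff_subset)
  · intro Z _
    change Z ∩ p ∪ Z \ p = Z
    rw [Finset.union_comm, Finset.sdiff_union_inter]
  · rintro ⟨Y, Y'⟩ hY
    simp only [Finset.mem_product, Finset.mem_powerset] at hY
    have h1 : ∀ a ∈ Y, a ∈ p := fun a ha => (Finset.mem_inter.1 (hY.1 ha)).2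
    have h2 : ∀ a ∈ Y', a ∉ p := fun a ha => (Finset.mem_sdiff.1 (hY.2 ha)).2
    ext a <;> simp only [Finset.mem_inter, Finset.mem_sdiff, Finset.mem_union] <;> grind
  · intro Z _
    rfl

/-! ### Vanishing under splitting -/

theorem split_nu (L : List (Finset ℕ+)) (Z : Finset ℕ+) :
    split F L (nu F Z) = MonoidAlgebra.single (restrTuple L (letter Z)) 1 := split_single ..

theorem restrTuple_letter_apply {L : List (Finset ℕ+)} {p : Finset ℕ+} (hp : p ∈ L)
    (Z : Finset ℕ+) : restrTuple L (letter Z) p = letter (p ∩ Z) := by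
  simp [restrTuple, hp, restr_letter]

theorem restrTuple_apply_of_notMem {L : List (Finset ℕ+)} {p : Finset ℕ+} (hp : p ∉ L)
    (w : Word) : restrTuple L w p = 1 := by
  simp [restrTuple, hp]

theorem eq_of_mem_of_mem {L : List (Finset ℕ+)} (hL : L.Pairwise Disjoint) {p q : Finset ℕ+}
    (hp : p ∈ L) (hq : q ∈ L) {a : ℕ+} (hap : a ∈ p) (haq : a ∈ q) : p = q := by
  by_contra hne
  exact Finset.disjoint_left.1 (hL.forall hp hq hne) hap haq

theorem restrTuple_letter {L : List (Finset ℕ+)} (hL : L.Pairwise Disjoint) {p : Finset ℕ+}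
    (hp : p ∈ L) (Z : Finset ℕ+) : restrTuple L (letter Z) =
      restrTuple L (letter (Z ∩ p)) * restrTuple L (letter (Z \ p)) := by
  ext1 q
  rw [Pi.mul_apply]
  by_cases hq : q ∈ L
  · simp only [restrTuple_letter_apply hq]
    by_cases hqp : q = p
    · subst hqp
      rw [show q ∩ (Z ∩ q) = q ∩ Z by grind, show q ∩ (Z \ q) = ∅ by grind, letter_empty, mul_one]
    · have hd : Disjoint q p := hL.forall hq hp hqp
      rw [Finset.disjoint_left] at hd
      rw [show q ∩ (Z ∩ p) = ∅ by grind, show q ∩ (Z \ p) = q ∩ Z by grind, letter_empty, one_mul]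
  · simp only [restrTuple_apply_of_notMem hq, one_mul]

/-- The first tuple is trivial outside coordinate `p`, the second is trivial at `p`. -/
theorem commute_restrTuple_letter {L : List (Finset ℕ+)} (hL : L.Pairwise Disjoint)
    {p Z Z' : Finset ℕ+} (hp : p ∈ L) (hZ : Z ⊆ p) (hZ' : Disjoint Z' p) :
    Commute (restrTuple L (letter Z)) (restrTuple L (letter Z')) := by
  ext1 q
  rw [Pi.mul_apply, Pi.mul_apply]
  by_cases hq : q ∈ L
  · simp only [restrTuple_letter_apply hq]
    rw [Finset.disjoint_left] at hZ'
    by_cases hqp : q = p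
    · subst hqp
      rw [show q ∩ Z' = ∅ by grind, letter_empty, mul_one, one_mul]
    · have hd : Disjoint q p := hL.forall hq hp hqp
      rw [Finset.disjoint_left] at hd
      rw [show q ∩ Z = ∅ by grind, letter_empty, mul_one, one_mul]
  · simp only [restrTuple_apply_of_notMem hq]

variable (F) in
/-- The subalgebra generated by the letters contained in `p`. -/
def polyIn (p : Finset ℕ+) : Subalgebra F (WAlg F) :=
  Algebra.adjoin F {x | ∃ Z ⊆ p, x = nu F Z}

theorem nu_mem_polyIn {p Z : Finset ℕ+} (h : Z ⊆ p) : nu F Z ∈ polyIn F p :=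
  Algebra.subset_adjoin ⟨Z, h, rfl⟩

theorem single_mem_polyIn {p : Finset ℕ+} {l : List (Finset ℕ+)}
    (h : ∀ z ∈ l, z.Nonempty ∧ z ⊆ p) (c : F) :
    MonoidAlgebra.single (FreeMonoid.ofList l) c ∈ polyIn F p := by
  induction l generalizing c with
  | nil =>
    have : (MonoidAlgebra.single (FreeMonoid.ofList []) c : WAlg F) = c • 1 := by
      simp [MonoidAlgebra.one_def]
    rw [this]
    exact (polyIn F p).smul_mem (one_mem _) c
  | cons z l ih =>
    simp only [List.mem_cons, forall_eq_or_imp] at h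
    rw [FreeMonoid.ofList_cons, ← one_mul c, ← MonoidAlgebra.single_mul_single,
      ← letter_of_nonempty h.1.1]
    exact mul_mem (nu_mem_polyIn h.1.2) (ih h.2 c)

theorem altSum_mem_polyIn {p X : Finset ℕ+} (h : X ⊆ p) : altSum F X ∈ polyIn F p :=
  sum_mem fun P _ => single_mem_polyIn
    (fun z hz => ⟨P.val.nonempty z hz, (Comp.subset_of_mem hz).trans h⟩) _

theorem commute_split {L : List (Finset ℕ+)} (hL : L.Pairwise Disjoint)
    {p q : Finset ℕ+} (hp : p ∈ L) (hq : Disjoint q p) {x y : WAlg F} (hx : x ∈ polyIn F p)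
    (hy : y ∈ polyIn F q) : Commute (split F L x) (split F L y) := by
  have hx' : split F L x ∈ Algebra.adjoin F (split F L '' {x | ∃ Z ⊆ p, x = nu F Z}) := by
    rw [← AlgHom.map_adjoin]
    exact ⟨x, hx, rfl⟩
  have hy' : split F L y ∈ Algebra.adjoin F (split F L '' {x | ∃ Z ⊆ q, x = nu F Z}) := by
    rw [← AlgHom.map_adjoin]
    exact ⟨y, hy, rfl⟩
  refine Algebra.commute_of_mem_adjoin_of_forall_mem_commute hy' ?_
  rintro _ ⟨_, ⟨Z', hZ', rfl⟩, rfl⟩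
  refine (Algebra.commute_of_mem_adjoin_of_forall_mem_commute hx' ?_).symm
  rintro _ ⟨_, ⟨Z, hZ, rfl⟩, rfl⟩
  rw [split_nu, split_nu]
  exact MonoidAlgebra.single_commute_single
    (commute_restrTuple_letter hL hp hZ (Finset.disjoint_of_subset_left hZ' hq)).symm
    (Commute.all _ _)

theorem split_nu_eq_mul {L : List (Finset ℕ+)} (hL : L.Pairwise Disjoint) {p : Finset ℕ+}
    (hp : p ∈ L) (Z : Finset ℕ+) :
    split F L (nu F Z) = split F L (nu F (Z ∩ p)) * split F L (nu F (Z \ p)) := by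
  rw [split_nu, split_nu, split_nu, MonoidAlgebra.single_mul_single, one_mul,
    restrTuple_letter hL hp]

/-- After splitting, factors inside `p` commute with those outside, so the sum factors; the outer
factor is the convolution of `nu` with its inverse over `X \ p`. The weight `k` sees only `Z ∩ p`:
constant weight gives multiplicativity of `altSum`, and the indicator of `a ∈ Y` gives the vanishing
of `e_X`. -/
theorem sum_split_nu_mul {L : List (Finset ℕ+)} (hL : L.Pairwise Disjoint) {p : Finset ℕ+}
    (hp : p ∈ L) (X : Finset ℕ+) (k : Finset ℕ+ → F) :
    ∑ Z ∈ X.powerset, k (Z ∩ p) • (split F L (nu F Z) *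
      (split F L (altSum F ((X \ Z) ∩ p)) * split F L (altSum F ((X \ Z) \ p)))) =
    (∑ Y ∈ (X ∩ p).powerset, k Y • split F L (nu F Y * altSum F ((X ∩ p) \ Y))) *
      split F L (if X \ p = ∅ then 1 else 0) := by
  rw [← sum_nu_mul_altSum, map_sum, Finset.sum_mul_sum, ← sum_powerset_inter_sdiff X p
    fun Y Y' => k Y • split F L (nu F Y * altSum F ((X ∩ p) \ Y)) *
      split F L (nu F Y' * altSum F ((X \ p) \ Y'))]
  refine Finset.sum_congr rfl fun Z _ => ?_
  have hc := commute_split hL hp Finset.sdiff_disjoint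
    (altSum_mem_polyIn (F := F) (Finset.inter_subset_right (s₁ := X \ Z)))
    (nu_mem_polyIn (F := F) (le_refl (Z \ p)))
  rw [show (X ∩ p) \ (Z ∩ p) = (X \ Z) ∩ p by grind, show (X \ p) \ (Z \ p) = (X \ Z) \ p by grind,
    split_nu_eq_mul hL hp, smul_mul_assoc, map_mul, map_mul]
  congr 1
  simp only [mul_assoc]
  rw [← mul_assoc (split F L (nu F (Z \ p))), ← hc.eq, mul_assoc]

/-- Both sides are convolution inverses of the split `nu`, and such an inverse is unique. -/
theorem split_altSum_eq_mul {L : List (Finset ℕ+)} (hL : L.Pairwise Disjoint) {p : Finset ℕ+}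
    (hp : p ∈ L) (X : Finset ℕ+) :
    split F L (altSum F X) = split F L (altSum F (X ∩ p)) * split F L (altSum F (X \ p)) := by
  refine congrFun (eq_of_sum_powerset_mul_eq (f := fun Z => split F L (nu F Z))
    (S := fun X => split F L (altSum F X))
    (S' := fun X => split F L (altSum F (X ∩ p)) * split F L (altSum F (X \ p)))
    (by simp [nu_empty]) fun X => ?_) X
  have h1 := sum_split_nu_mul (F := F) hL hp X fun _ => 1
  simp only [one_smul] at h1
  rw [h1, ← map_sum, sum_nu_mul_altSum, ← map_mul]
  simp only [← map_mul, ← map_sum, sum_nu_mul_altSum]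
  congr 1
  have h2 : X = ∅ ↔ X ∩ p = ∅ ∧ X \ p = ∅ := by
    constructor
    · rintro rfl
      simp
    · rintro ⟨h, h'⟩
      rw [← Finset.sdiff_union_inter X p, h, h', Finset.empty_union]
  by_cases h : X ∩ p = ∅ <;> by_cases h' : X \ p = ∅ <;> simp [h2, h, h']

/-! ### The elements `e_X` as polynomials -/

variable (F) in
open Classical in
/-- The element `e_X` as a noncommutative polynomial. -/
def ePoly (X : Finset ℕ+) : WAlg F :=
  ∑ P : Comp X with P.MinInFirst,
    MonoidAlgebra.single (FreeMonoid.ofList P.parts) ((-1) ^ (P.parts.length - 1))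

theorem ePoly_mem_polyIn {p X : Finset ℕ+} (h : X ⊆ p) : ePoly F X ∈ polyIn F p :=
  sum_mem fun P _ => single_mem_polyIn
    (fun z hz => ⟨P.val.nonempty z hz, (Comp.subset_of_mem hz).trans h⟩) _

theorem ePoly_eq {X : Finset ℕ+} {a : ℕ+} (ha : X.min = a) :
    ePoly F X = ∑ Z ∈ X.powerset with a ∈ Z, nu F Z * altSum F (X \ Z) := by
  classical
  have hX : X.Nonempty := ⟨a, Finset.mem_of_min ha⟩
  -- The summand is made an opaque function of the list of components, the form needed by
  -- `sum_comp`.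
  obtain ⟨f, hf⟩ : ∃ f : List (Finset ℕ+) → WAlg F, ∀ L, f L =
      if ∃ p ∈ L.head?, ∃ b ∈ p, X.min = b then MonoidAlgebra.single (FreeMonoid.ofList L)
        ((-1 : F) ^ (L.length - 1)) else 0 := ⟨_, fun _ => rfl⟩
  have h1 : ePoly F X = ∑ P : Comp X, f P.parts := by
    rw [ePoly, Finset.sum_filter]
    refine Finset.sum_congr rfl fun P _ => ?_
    rw [hf]
    exact if_congr Iff.rfl rfl rfl
  have h2 : {Z ∈ X.powerset | a ∈ Z} = {Z ∈ {Z ∈ X.powerset | Z.Nonempty} | a ∈ Z} := by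
    ext Z
    simp only [Finset.mem_filter]
    exact ⟨fun h => ⟨⟨h.1, a, h.2⟩, h.2⟩, fun h => ⟨h.1.1, h.2⟩⟩
  rw [h1, sum_comp hX, h2, Finset.sum_filter (fun Z => a ∈ Z)]
  refine Finset.sum_congr rfl fun Z hZ => ?_
  rw [nu_mul_altSum (Finset.mem_filter.1 hZ).2]
  have h3 : ∀ b : ℕ+, (a : WithTop ℕ+) = b ↔ a = b := fun b => WithTop.coe_inj
  by_cases haZ : a ∈ Z <;> simp [hf, ha, h3, haZ]

/-- Since `a ∈ p`, the condition `a ∈ Z` depends only on `Z ∩ p`. The sum therefore has the factor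
that belongs to `X \ p`, which is zero for nonempty `X \ p`. -/
theorem split_ePoly_eq_zero {L : List (Finset ℕ+)} (hL : L.Pairwise Disjoint) {X : Finset ℕ+}
    {a : ℕ+} (ha : X.min = a) {p : Finset ℕ+} (hp : p ∈ L) (hap : a ∈ p) (hX : ¬ X ⊆ p) :
    split F L (ePoly F X) = 0 := by
  have h1 := sum_split_nu_mul (F := F) hL hp X fun Y => if a ∈ Y then 1 else 0
  rw [if_neg (by rwa [Finset.sdiff_eq_empty_iff_subset]), map_zero, mul_zero] at h1
  rw [ePoly_eq ha, map_sum, Finset.sum_filter]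
  refine Eq.trans (Finset.sum_congr rfl fun Z _ => ?_) h1
  rw [← split_altSum_eq_mul hL hp, map_mul]
  by_cases haZ : a ∈ Z <;> simp [haZ, hap]

variable (F) in
/-- The algebra endomorphism that maps all letters outside `S` to zero. -/
def keep (S : List (Finset ℕ+)) : WAlg F →ₐ[F] WAlg F :=
  MonoidAlgebra.lift F (WAlg F) Word (FreeMonoid.lift fun Z =>
    open Classical in if Z ∈ S then MonoidAlgebra.single (FreeMonoid.of Z) 1 else 0)

theorem keep_single_of_forall_mem {S l : List (Finset ℕ+)} (h : ∀ z ∈ l, z ∈ S) (c : F) :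
    keep F S (MonoidAlgebra.single (FreeMonoid.ofList l) c) =
      MonoidAlgebra.single (FreeMonoid.ofList l) c := by
  rw [keep, MonoidAlgebra.lift_single, FreeMonoid.lift_ofList]
  have key : (l.map fun Z => open Classical in if Z ∈ S then
      (MonoidAlgebra.single (FreeMonoid.of Z) 1 : WAlg F) else 0).prod =
      MonoidAlgebra.single (FreeMonoid.ofList l) 1 := by
    induction l with
    | nil => rfl
    | cons z l ih =>
      simp only [List.mem_cons, forall_eq_or_imp] at h
      rw [List.map_cons, List.prod_cons, ih h.2, if_pos h.1, MonoidAlgebra.single_mul_single,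
        one_mul, FreeMonoid.ofList_cons]
  rw [key, MonoidAlgebra.smul_single, smul_eq_mul, mul_one]

theorem keep_single_of_exists_notMem {S l : List (Finset ℕ+)} (h : ∃ z ∈ l, z ∉ S) (c : F) :
    keep F S (MonoidAlgebra.single (FreeMonoid.ofList l) c) = 0 := by
  rw [keep, MonoidAlgebra.lift_single, FreeMonoid.lift_ofList, List.prod_eq_zero, smul_zero]
  obtain ⟨z, hz, hzS⟩ := h
  exact List.mem_map.2 ⟨z, hz, if_neg hzS⟩

/-- A surviving word starts with a letter of `S` that contains `min X`; by disjointness this letter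
is `X`, and nothing is left for further letters. -/
theorem keep_ePoly {S : List (Finset ℕ+)} (hS : S.Pairwise Disjoint) {X : Finset ℕ+}
    (hX : X.Nonempty) (hXS : X ∈ S) :
    keep F S (ePoly F X) = MonoidAlgebra.single (FreeMonoid.of X) 1 := by
  obtain ⟨a, ha⟩ := Finset.min_of_nonempty hX
  have haX := Finset.mem_of_min ha
  rw [ePoly_eq ha, map_sum, Finset.sum_eq_single X]
  · rw [Finset.sdiff_self, altSum_empty, mul_one, nu, letter_of_nonempty hX]
    exact keep_single_of_forall_mem (l := [X]) (by simpa using hXS) 1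
  · intro Z hZ hne
    obtain ⟨hZX, haZ⟩ := Finset.mem_filter.1 hZ
    rw [map_mul, nu, letter_of_nonempty ⟨a, haZ⟩]
    rw [show keep F S (MonoidAlgebra.single (FreeMonoid.of Z) 1) = 0 from
      keep_single_of_exists_notMem (l := [Z]) (by
        simpa using fun h => hne (eq_of_mem_of_mem hS h hXS haZ haX)) 1, zero_mul]
  · intro h
    simp [haX] at h

end

end SolomonTits


namespace SolomonTits

noncomputable section

variable {F : Type*} [Field F]

/-! ### Nested brackets -/

variable (F) in
/-- The nested bracket `[e_{x₁}, [e_{x₂}, …, e_{xₘ}]]`. -/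
def bracket : List (Finset ℕ+) → WAlg F
  | [] => 1
  | [x] => ePoly F x
  | x :: y :: l => ePoly F x * bracket (y :: l) - bracket (y :: l) * ePoly F x

@[simp] theorem bracket_singleton (x : Finset ℕ+) : bracket F [x] = ePoly F x := rfl

theorem bracket_cons (x : Finset ℕ+) {u : List (Finset ℕ+)} (hu : u ≠ []) :
    bracket F (x :: u) = ePoly F x * bracket F u - bracket F u * ePoly F x := by
  cases u with
  | nil => exact absurd rfl hu
  | cons y l => rfl

variable (F) in
/-- The product of the nested brackets of a list of lists. -/
def brackets (U : List (List (Finset ℕ+))) : WAlg F := (U.map (bracket F)).prod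

@[simp] theorem brackets_cons (u : List (Finset ℕ+)) (U : List (List (Finset ℕ+))) :
    brackets F (u :: U) = bracket F u * brackets F U := by
  simp [brackets]

theorem brackets_append (U V : List (List (Finset ℕ+))) :
    brackets F (U ++ V) = brackets F U * brackets F V := by
  simp [brackets]

theorem bracket_mem_polyIn {p : Finset ℕ+} {u : List (Finset ℕ+)} (h : ∀ q ∈ u, q ⊆ p) :
    bracket F u ∈ polyIn F p := by
  induction u with
  | nil => exact one_mem _
  | cons x u ih =>
    simp only [List.mem_cons, forall_eq_or_imp] at h
    by_cases hu : u = []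
    · subst hu
      exact ePoly_mem_polyIn h.1
    · rw [bracket_cons x hu]
      exact sub_mem (mul_mem (ePoly_mem_polyIn h.1) (ih h.2))
        (mul_mem (ih h.2) (ePoly_mem_polyIn h.1))

/-- By induction on the nesting: `e_x` vanishes unless `x` lies in one component, and if the inner
bracket lies in a different component, the two images commute. -/
theorem split_bracket {L : List (Finset ℕ+)} (hL : L.Pairwise Disjoint) {u : List (Finset ℕ+)}
    (hu0 : u ≠ []) (hu : ∀ q ∈ u, q.Nonempty ∧ q ⊆ unionL L) :
    split F L (bracket F u) = 0 ∨ ∃ p ∈ L, ∀ q ∈ u, q ⊆ p := by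
  induction u with
  | nil => exact absurd rfl hu0
  | cons x u ih =>
    simp only [List.mem_cons, forall_eq_or_imp] at hu
    obtain ⟨a, ha⟩ := Finset.min_of_nonempty hu.1.1
    obtain ⟨p, hp, hap⟩ := mem_unionL.1 (hu.1.2 (Finset.mem_of_min ha))
    by_cases hxp : x ⊆ p
    · by_cases hu1 : u = []
      · subst hu1
        exact Or.inr ⟨p, hp, by simpa using hxp⟩
      · rw [bracket_cons x hu1]
        rcases ih hu1 hu.2 with h | ⟨p', hp', h⟩
        · left
          simp [h]
        · by_cases hpp : p' = p
          · subst hpp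
            right
            refine ⟨p', hp, ?_⟩
            simp only [List.mem_cons, forall_eq_or_imp]
            exact ⟨hxp, h⟩
          · left
            rw [map_sub, map_mul, map_mul, sub_eq_zero]
            exact commute_split hL hp (hL.forall hp' hp hpp) (ePoly_mem_polyIn hxp)
              (bracket_mem_polyIn h)
    · left
      have h0 := split_ePoly_eq_zero (F := F) hL ha hp hap hxp
      by_cases hu1 : u = []
      · subst hu1
        exact h0
      · rw [bracket_cons x hu1, map_sub, map_mul, map_mul, h0, zero_mul, mul_zero, sub_zero]

theorem act_brackets_eq_zero {L : List (Finset ℕ+)} (hL : L.Pairwise Disjoint)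
    {U : List (List (Finset ℕ+))} {u : List (Finset ℕ+)} (huU : u ∈ U)
    (hu0 : u ≠ []) (hu : ∀ q ∈ u, q.Nonempty ∧ q ⊆ unionL L)
    (h : ¬ ∃ p ∈ L, ∀ q ∈ u, q ⊆ p) : act F L (brackets F U) = 0 := by
  refine act_eq_zero_of_split_eq_zero ?_
  rw [brackets, map_list_prod, List.map_map]
  exact List.prod_eq_zero (List.mem_map.2 ⟨u, huU, (split_bracket hL hu0 hu).resolve_right h⟩)

theorem mem_span_of_mem_polyIn {p : Finset ℕ+} {x : WAlg F} (hx : x ∈ polyIn F p) :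
    x ∈ Submodule.span F {y : WAlg F | ∃ v : Word, (∀ z ∈ v.toList, z.Nonempty ∧ z ⊆ p) ∧
      y = MonoidAlgebra.single v 1} := by
  induction hx using Algebra.adjoin_induction with
  | mem x hx =>
    obtain ⟨Z, hZ, rfl⟩ := hx
    refine Submodule.subset_span ⟨letter Z, ?_, rfl⟩
    by_cases h : Z.Nonempty
    · rw [letter_of_nonempty h]
      simpa using ⟨h, hZ⟩
    · simp [letter, h]
  | algebraMap r =>
    rw [Algebra.algebraMap_eq_smul_one]
    exact Submodule.smul_mem _ _ (Submodule.subset_span ⟨1, by simp, rfl⟩)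
  | add x y _ _ hx hy => exact add_mem hx hy
  | mul x y _ _ hx hy =>
    have h := Submodule.mul_mem_mul hx hy
    rw [Submodule.span_mul_span] at h
    refine Submodule.span_mono ?_ h
    rintro _ ⟨_, ⟨v, hv, rfl⟩, _, ⟨v', hv', rfl⟩, rfl⟩
    refine ⟨v * v', ?_, by simp [MonoidAlgebra.single_mul_single]⟩
    intro z hz
    rw [FreeMonoid.toList_mul, List.mem_append] at hz
    exact hz.elim (hv z) (hv' z)

/-- Exhibits the product as linear in `y`, so that in `act_single_mul_prod` a polynomial can be
replaced by a single word. -/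
theorem exists_prod_map_ite_eq {B ι : Type*} [Ring B] [DecidableEq ι] {L : List ι} (hL : L.Nodup)
    {c : ι} (hc : c ∈ L) (g h : ι → B) : ∃ x z : B, ∀ y : B,
      (L.map fun p => g p * ((if c = p then y else 1) * h p)).prod = x * (y * z) := by
  obtain ⟨L₁, L₂, rfl⟩ := List.append_of_mem hc
  have h1 : c ∉ L₁ := fun hm =>
    (List.nodup_append.1 hL).2.2 c hm c List.mem_cons_self rfl
  have h2 : c ∉ L₂ := (List.nodup_cons.1 (List.nodup_append.1 hL).2.1).1
  refine ⟨(L₁.map fun p => g p * h p).prod * g c, h c * (L₂.map fun p => g p * h p).prod,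
    fun y => ?_⟩
  have h3 : ∀ L' : List ι, c ∉ L' → (L'.map fun p => g p * ((if c = p then y else 1) * h p)) =
      L'.map fun p => g p * h p := fun L' hL' => List.map_congr_left fun p hp => by
    have hne : c ≠ p := fun hcp => hL' (hcp ▸ hp)
    rw [if_neg hne, one_mul]
  rw [List.map_append, List.map_cons, List.prod_append, List.prod_cons, h3 L₁ h1, h3 L₂ h2,
    if_pos rfl]
  simp only [mul_assoc]

theorem act_single_mul_prod {ι : Type*} {L : List (Finset ℕ+)} (hL : L.Pairwise Disjoint)
    (hLn : L.Nodup) (c : ι → Finset ℕ+) (a : ι → WAlg F) (U : List ι) (hc : ∀ i ∈ U, c i ∈ L)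
    (ha : ∀ i ∈ U, a i ∈ polyIn F (c i)) (w : Word) :
    act F L (MonoidAlgebra.single w 1 * (U.map a).prod) =
      (L.map fun p => MonoidAlgebra.single (restr p w) 1 *
        ((U.filter fun i => c i = p).map a).prod).prod := by
  induction U generalizing w with
  | nil =>
    simp only [List.map_nil, List.prod_nil, mul_one, List.filter_nil, act_single]
    clear hL hLn hc
    induction L with
    | nil => rfl
    | cons p L ih => rw [List.map_cons, List.prod_cons, List.map_cons, List.prod_cons, ← ih,
        MonoidAlgebra.single_mul_single, one_mul]
  | cons i U ih =>
    simp only [List.mem_cons, forall_eq_or_imp] at hc ha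
    have h1 : ∀ p, (((i :: U).filter fun i => c i = p).map a).prod =
        (if c i = p then a i else 1) * ((U.filter fun i => c i = p).map a).prod := by
      intro p
      by_cases h : c i = p <;> simp [h]
    simp only [h1]
    obtain ⟨x, z, hxz⟩ := exists_prod_map_ite_eq hLn hc.1
      (fun p => (MonoidAlgebra.single (restr p w) 1 : WAlg F))
      fun p => ((U.filter fun i => c i = p).map a).prod
    rw [hxz, List.map_cons, List.prod_cons]
    -- By linearity the first factor is a word `v` with letters inside `c i`. It is absorbed into
    -- the prefix `w`: restriction to `c i` fixes `v`, and restriction to the other components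
    -- erases it.
    have key : ∀ y ∈ Submodule.span F {y : WAlg F | ∃ v : Word,
        (∀ z ∈ v.toList, z.Nonempty ∧ z ⊆ c i) ∧ y = MonoidAlgebra.single v 1},
        act F L (MonoidAlgebra.single w 1 * (y * (U.map a).prod)) = x * (y * z) := by
      intro y hy
      induction hy using Submodule.span_induction with
      | mem y hy =>
        obtain ⟨v, hv, rfl⟩ := hy
        rw [← mul_assoc, MonoidAlgebra.single_mul_single, one_mul, ih hc.2 ha.2, ← hxz]
        congr 1
        refine List.map_congr_left fun p hp => ?_
        rw [← mul_assoc]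
        congr 1
        by_cases h : c i = p
        · subst h
          rw [map_mul, if_pos rfl, MonoidAlgebra.single_mul_single, one_mul, restr_eq_self hv]
        · rw [if_neg h, mul_one, map_mul, restr_eq_one (w := v), mul_one]
          exact fun z hz => Finset.disjoint_of_subset_right (hv z hz).2
            (hL.forall hp hc.1 (Ne.symm h))
      | zero => simp
      | add y y' _ _ hy hy' => simp only [add_mul, mul_add, map_add, hy, hy']
      | smul r y _ hy =>
        rw [smul_mul_assoc, mul_smul_comm, map_smul, hy, smul_mul_assoc, mul_smul_comm]
    exact key _ (mem_span_of_mem_polyIn ha.1)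

theorem brackets_flatMap {ι : Type*} (L : List ι) (f : ι → List (List (Finset ℕ+))) :
    brackets F (L.flatMap f) = (L.map fun p => brackets F (f p)).prod := by
  induction L with
  | nil => rfl
  | cons p L ih => rw [List.flatMap_cons, brackets_append, ih, List.map_cons, List.prod_cons]

theorem act_brackets {L : List (Finset ℕ+)} (hL : L.Pairwise Disjoint) (hLn : L.Nodup)
    {U : List (List (Finset ℕ+))} (c : List (Finset ℕ+) → Finset ℕ+)
    (hc : ∀ u ∈ U, c u ∈ L ∧ ∀ q ∈ u, q ⊆ c u) :
    act F L (brackets F U) =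
      brackets F (L.flatMap fun p => U.filter fun u => c u = p) := by
  have h := act_single_mul_prod (F := F) hL hLn c (bracket F) U (fun u hu => (hc u hu).1)
    (fun u hu => bracket_mem_polyIn (hc u hu).2) 1
  rw [← MonoidAlgebra.one_def, one_mul] at h
  rw [brackets_flatMap, brackets, h]
  congr 1
  refine List.map_congr_left fun p _ => ?_
  rw [map_one, ← MonoidAlgebra.one_def, one_mul, brackets]

theorem flatMap_filter_perm {ι κ : Type*} [DecidableEq κ] {L : List κ} (hLn : L.Nodup)
    (c : ι → κ) {U : List ι} (hc : ∀ u ∈ U, c u ∈ L) :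
    (L.flatMap fun p => U.filter fun u => c u = p).Perm U := by
  induction L generalizing U with
  | nil =>
    cases U with
    | nil => rfl
    | cons u U => exact absurd (hc u List.mem_cons_self) List.not_mem_nil
  | cons p L ih =>
    rw [List.flatMap_cons]
    have h1 : (L.flatMap fun p' => U.filter fun u => c u = p') =
        L.flatMap fun p' => (U.filter fun u => ¬ c u = p).filter fun u => c u = p' := by
      simp only [List.flatMap]
      congr 1
      refine List.map_congr_left fun p' hp' => ?_
      rw [List.filter_filter]
      refine List.filter_congr fun u _ => ?_
      have hne : p' ≠ p := fun h => (List.nodup_cons.1 hLn).1 (h ▸ hp')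
      by_cases h : c u = p' <;> simp [h, hne]
    rw [h1]
    refine ((ih (List.nodup_cons.1 hLn).2 fun u hu => ?_).append_left _).trans ?_
    · obtain ⟨hu, hup⟩ := List.mem_filter.1 hu
      exact (List.mem_cons.1 (hc u hu)).resolve_left (by simpa using hup)
    · simpa using List.filter_append_perm (fun u => decide (c u = p)) U

/-! ### The filtration by the number of brackets -/

variable (F) in
/-- The span of the products of fewer than `n` nested brackets that involve the letters of `l`. -/
def fewBrackets (l : List (Finset ℕ+)) (n : ℕ) : Submodule F (WAlg F) :=
  Submodule.span F {x | ∃ U : List (List (Finset ℕ+)), U.flatten.Perm l ∧ [] ∉ U ∧ U.length < n ∧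
    x = brackets F U}

theorem brackets_mem_fewBrackets {l : List (Finset ℕ+)} {n : ℕ} {U : List (List (Finset ℕ+))}
    (h1 : U.flatten.Perm l) (h2 : [] ∉ U) (h3 : U.length < n) :
    brackets F U ∈ fewBrackets F l n :=
  Submodule.subset_span ⟨U, h1, h2, h3, rfl⟩

theorem fewBrackets_mono (l : List (Finset ℕ+)) {m n : ℕ} (h : m ≤ n) :
    fewBrackets F l m ≤ fewBrackets F l n :=
  Submodule.span_mono fun _ ⟨U, h1, h2, h3, hx⟩ => ⟨U, h1, h2, h3.trans_le h, hx⟩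

theorem fewBrackets_perm {l l' : List (Finset ℕ+)} (h : l.Perm l') (n : ℕ) :
    fewBrackets F l n ≤ fewBrackets F l' n :=
  Submodule.span_mono fun _ ⟨U, h1, h2, h3, hx⟩ => ⟨U, h1.trans h, h2, h3, hx⟩

theorem bracket_mul_mem_fewBrackets {l u : List (Finset ℕ+)} (hu : u ≠ []) {n : ℕ} {x : WAlg F}
    (hx : x ∈ fewBrackets F l n) : bracket F u * x ∈ fewBrackets F (u ++ l) (n + 1) := by
  have h : fewBrackets F l n ≤
      (fewBrackets F (u ++ l) (n + 1)).comap (LinearMap.mulLeft F (bracket F u)) := by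
    refine Submodule.span_le.2 ?_
    rintro _ ⟨U, h1, h2, h3, rfl⟩
    rw [SetLike.mem_coe, Submodule.mem_comap, LinearMap.mulLeft_apply, ← brackets_cons]
    refine brackets_mem_fewBrackets ?_ ?_ (by simpa using h3)
    · rw [List.flatten_cons]
      exact h1.append_left u
    · simpa [hu.symm] using h2
  exact h hx

theorem commutator_mul_sub {B : Type*} [Ring B] (a b c : B) :
    (a * b - b * a) * c - c * (a * b - b * a) =
      (a * (b * c - c * b) - (b * c - c * b) * a) - (b * (a * c - c * a) - (a * c - c * a) * b) := by
  noncomm_ring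

/-- The Jacobi identity: it shortens the left bracket at the expense of the right one. -/
theorem commutator_bracket_cons (x : Finset ℕ+) {u v : List (Finset ℕ+)} (hu : u ≠ [])
    (hv : v ≠ []) :
    bracket F (x :: u) * bracket F v - bracket F v * bracket F (x :: u) =
      (ePoly F x * (bracket F u * bracket F v - bracket F v * bracket F u) -
        (bracket F u * bracket F v - bracket F v * bracket F u) * ePoly F x) -
      (bracket F u * bracket F (x :: v) - bracket F (x :: v) * bracket F u) := by
  rw [bracket_cons x hu, bracket_cons x hv]
  generalize bracket F u = b
  generalize bracket F v = c
  generalize ePoly F x = a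
  exact commutator_mul_sub a b c

variable (F) in
/-- The span of the brackets of the rearrangements of a list. -/
def bracketSpan (l : List (Finset ℕ+)) : Submodule F (WAlg F) :=
  Submodule.span F {x | ∃ w : List (Finset ℕ+), w.Perm l ∧ x = bracket F w}

theorem bracketSpan_perm {l l' : List (Finset ℕ+)} (h : l.Perm l') :
    bracketSpan F l ≤ bracketSpan F l' :=
  Submodule.span_mono fun _ ⟨w, hw, hx⟩ => ⟨w, hw.trans h, hx⟩

theorem commutator_ePoly_mem (x : Finset ℕ+) {l : List (Finset ℕ+)} (hl : l ≠ []) {y : WAlg F}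
    (hy : y ∈ bracketSpan F l) :
    ePoly F x * y - y * ePoly F x ∈ bracketSpan F (x :: l) := by
  induction hy using Submodule.span_induction with
  | mem y hy =>
    obtain ⟨w, hw, rfl⟩ := hy
    have hw0 : w ≠ [] := by
      rintro rfl
      exact hl hw.symm.eq_nil
    rw [← bracket_cons x hw0]
    exact Submodule.subset_span ⟨x :: w, hw.cons x, rfl⟩
  | zero => simp
  | add y z _ _ hy hz =>
    rw [mul_add, add_mul, add_sub_add_comm]
    exact add_mem hy hz
  | smul r y _ hy =>
    rw [mul_smul_comm, smul_mul_assoc, ← smul_sub]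
    exact Submodule.smul_mem _ r hy

theorem commutator_bracket_mem {u v : List (Finset ℕ+)} (hu : u ≠ []) (hv : v ≠ []) :
    bracket F u * bracket F v - bracket F v * bracket F u ∈ bracketSpan F (u ++ v) := by
  induction u generalizing v with
  | nil => exact absurd rfl hu
  | cons x u ih =>
    by_cases hu1 : u = []
    · subst hu1
      rw [bracket_singleton, ← bracket_cons x hv]
      exact Submodule.subset_span ⟨x :: v, List.Perm.refl _, rfl⟩
    · rw [commutator_bracket_cons x hu1 hv]
      refine sub_mem ?_ ?_
      · exact commutator_ePoly_mem x (by simp [hu1]) (ih hu1 hv)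
      · exact bracketSpan_perm List.perm_middle (ih hu1 (List.cons_ne_nil x v))

/-- Swapping two neighbours costs their commutator, a combination of single brackets, so two factors
are replaced by one. -/
theorem brackets_sub_brackets_mem {U V : List (List (Finset ℕ+))} (h : U.Perm V) (hU : [] ∉ U) :
    brackets F U - brackets F V ∈ fewBrackets F U.flatten U.length := by
  induction h with
  | nil => simp
  | cons u h ih =>
    simp only [List.mem_cons, not_or] at hU
    rw [brackets_cons, brackets_cons, ← mul_sub]
    exact bracket_mul_mem_fewBrackets (Ne.symm hU.1) (ih hU.2)
  | swap u v U =>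
    simp only [List.mem_cons, not_or] at hU
    have h1 : brackets F (v :: u :: U) - brackets F (u :: v :: U) =
        (bracket F v * bracket F u - bracket F u * bracket F v) * brackets F U := by
      rw [brackets_cons, brackets_cons, brackets_cons, brackets_cons, sub_mul, mul_assoc, mul_assoc]
    rw [h1]
    have h2 : bracketSpan F (v ++ u) ≤
        (fewBrackets F (v :: u :: U).flatten (v :: u :: U).length).comap
          (LinearMap.mulRight F (brackets F U)) := by
      refine Submodule.span_le.2 ?_
      rintro _ ⟨w, hw, rfl⟩
      rw [SetLike.mem_coe, Submodule.mem_comap, LinearMap.mulRight_apply, ← brackets_cons]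
      refine brackets_mem_fewBrackets ?_ ?_ (by simp)
      · simpa using hw.append_right U.flatten
      · have hw0 : w ≠ [] := by
          rintro rfl
          have := hw.symm.eq_nil
          simp only [List.append_eq_nil_iff] at this
          exact hU.1 this.1.symm
        simpa [hw0.symm] using hU.2.2
    exact h2 (commutator_bracket_mem (Ne.symm hU.1) (Ne.symm hU.2.1))
  | trans h1 h2 ih1 ih2 =>
    rw [← sub_add_sub_cancel]
    refine add_mem (ih1 hU) ?_
    rw [h1.length_eq]
    exact fewBrackets_perm h1.flatten.symm _ (ih2 fun h => hU (h1.mem_iff.2 h))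

theorem keep_bracket_ne_zero {S : List (Finset ℕ+)} (hS : S.Pairwise Disjoint)
    (hSn : ∀ x ∈ S, x.Nonempty) {u : List (Finset ℕ+)} (hu : ∀ x ∈ u, x ∈ S) (hun : u.Nodup)
    (hu0 : u ≠ []) : keep F S (bracket F u) ≠ 0 := by
  have key : (keep F S (bracket F u)).coeff (FreeMonoid.ofList u) = 1 := by
    induction u with
    | nil => exact absurd rfl hu0
    | cons x u ih =>
      simp only [List.mem_cons, forall_eq_or_imp] at hu
      have hx := keep_ePoly (F := F) hS (hSn x hu.1) hu.1
      by_cases hu1 : u = []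
      · subst hu1
        rw [bracket_singleton, hx]
        simp
      · rw [bracket_cons x hu1, map_sub, map_mul, map_mul, hx, FreeMonoid.ofList_cons,
          MonoidAlgebra.coeff_sub, Finsupp.sub_apply,
          MonoidAlgebra.coeff_single_mul_eq_mul_coeff (FreeMonoid.ofList u)
            fun w _ => mul_right_inj _,
          MonoidAlgebra.coeff_mul_single_of_forall_mul_ne, sub_zero, one_mul]
        · exact ih hu.2 (List.nodup_cons.1 hun).2 hu1
        -- The subtracted product only has words ending in `x`, whereas `x u` ends in a letter of
        -- `u`, which differs from `x`. So the coefficient of the word itself stays 1.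
        · intro d hd
          obtain ⟨u', y, rfl⟩ := List.eq_nil_or_concat u |>.resolve_left hu1
          have hd' : d.toList ++ [x] = (x :: u') ++ [y] := by
            simpa using congrArg FreeMonoid.toList hd
          have hxy := (List.append_inj' hd' rfl).2
          simp only [List.cons.injEq, and_true] at hxy
          subst hxy
          exact (List.nodup_cons.1 hun).1 (by simp)
  intro h
  rw [h] at key
  simp at key

/-- The free algebra has no zero divisors, so it suffices that every bracket survives `keep`. -/
theorem brackets_ne_zero {S : List (Finset ℕ+)} (hS : S.Pairwise Disjoint)
    (hSn : ∀ x ∈ S, x.Nonempty) {U : List (List (Finset ℕ+))}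
    (hU : ∀ u ∈ U, u ≠ [] ∧ u.Nodup ∧ ∀ x ∈ u, x ∈ S) : brackets F U ≠ 0 := by
  intro h
  have h1 := congrArg (keep F S) h
  rw [brackets, map_list_prod, map_zero, List.prod_eq_zero_iff, List.map_map, List.mem_map] at h1
  obtain ⟨u, hu, hu'⟩ := h1
  exact keep_bracket_ne_zero hS hSn (hU u hu).2.2 (hU u hu).2.1 (hU u hu).1 hu'

end

end SolomonTits


namespace SolomonTits

noncomputable section

variable {F : Type*} [Field F] {A : Finset ℕ+}

/-! ### The Solomon-Tits algebra inside the algebra of words -/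

variable (F A) in
/-- The embedding of the Solomon-Tits algebra that reads a set composition as a word. -/
def toWords : Alg F A →ₗ[F] WAlg F :=
  MonoidAlgebra.mapDomainLinearMap F F fun P => FreeMonoid.ofList P.parts

@[simp] theorem toWords_single (P : Comp A) (c : F) : toWords F A (MonoidAlgebra.single P c) =
    MonoidAlgebra.single (FreeMonoid.ofList P.parts) c :=
  MonoidAlgebra.mapDomainLinearMap_single ..

theorem toWords_injective : Function.Injective (toWords F A) :=
  MonoidAlgebra.mapDomain_injective (R := F)
    (f := fun P : Comp A => FreeMonoid.ofList P.parts) fun _ _ h => Comp.ext_parts h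

theorem toWords_single_mul (P : Comp A) (x : Alg F A) :
    toWords F A (MonoidAlgebra.single P 1 * x) = act F P.parts (toWords F A x) := by
  induction x using MonoidAlgebra.induction_linear with
  | zero => simp
  | add x y hx hy => rw [mul_add, map_add, map_add, map_add, hx, hy]
  | single R c =>
    rw [MonoidAlgebra.single_mul_single, toWords_single, toWords_single, act_single, one_mul,
      ← ofList_clean_interL, Comp.parts_mul]

theorem eSet_supp {X : Finset ℕ+} {P : SetComp} (h : eSet F X P ≠ 0) : P.supp = X := by
  classical
  rw [eSet, Finsupp.finsetSum_apply] at h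
  obtain ⟨T, -, hT⟩ := Finset.exists_ne_zero_of_sum_ne_zero h
  have h2 : T.val = P := by
    by_contra hne
    exact hT (by simp [hne])
  rw [← h2]
  exact T.2

variable (F) in
/-- The linear map that reads a set composition of any set as a word. -/
def scToWords : (SetComp →₀ F) →ₗ[F] WAlg F :=
  Finsupp.linearCombination F fun P => MonoidAlgebra.single (FreeMonoid.ofList P.parts) 1

@[simp] theorem scToWords_single (P : SetComp) (c : F) : scToWords F (Finsupp.single P c) =
    MonoidAlgebra.single (FreeMonoid.ofList P.parts) c := by
  simp [scToWords]

theorem scToWords_apply (f : SetComp →₀ F) : scToWords F f =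
    ∑ P ∈ f.support, MonoidAlgebra.single (FreeMonoid.ofList P.parts) (f P) := by
  rw [scToWords, Finsupp.linearCombination_apply, Finsupp.sum]
  exact Finset.sum_congr rfl fun P _ => by rw [MonoidAlgebra.smul_single, smul_eq_mul, mul_one]

theorem scToWords_eSet (X : Finset ℕ+) : scToWords F (eSet F X) = ePoly F X := by
  rw [eSet, map_sum, ePoly]
  refine Finset.sum_congr rfl fun P _ => ?_
  rw [scToWords_single]
  rfl

theorem scToWords_vee {f g : SetComp →₀ F}
    (h : ∀ P, f P ≠ 0 → ∀ R, g R ≠ 0 → Disjoint P.supp R.supp) :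
    scToWords F (vee F f g) = scToWords F f * scToWords F g := by
  rw [vee, Finsupp.sum, map_sum, scToWords_apply f, scToWords_apply g, Finset.sum_mul]
  refine Finset.sum_congr rfl fun P hP => ?_
  rw [Finsupp.sum, map_sum, Finset.mul_sum]
  refine Finset.sum_congr rfl fun R hR => ?_
  rw [dif_pos (h P (Finsupp.mem_support_iff.1 hP) R (Finsupp.mem_support_iff.1 hR))]
  rw [scToWords_single, MonoidAlgebra.single_mul_single]
  rfl

theorem scToWords_eList {l : List (Finset ℕ+)} (hl : l.Pairwise Disjoint) :
    scToWords F (eList F l) = (l.map (ePoly F)).prod := by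
  induction l with
  | nil => simp [eList, emptyComp, MonoidAlgebra.one_def]
  | cons X l ih =>
    obtain ⟨hX, hl⟩ := List.pairwise_cons.1 hl
    have h1 : eList F (X :: l) = vee F (eSet F X) (eList F l) := rfl
    rw [h1, scToWords_vee, scToWords_eSet, ih hl, List.map_cons, List.prod_cons]
    intro P hP R hR
    rw [eSet_supp hP, eList_supp F l R hR, Finset.disjoint_left]
    intro a ha hal
    obtain ⟨q, hq, haq⟩ := mem_unionL.1 hal
    exact Finset.disjoint_left.1 (hX q hq) ha haq

theorem toWords_e (Q : Comp A) :
    toWords F A (e F Q) = brackets F (Q.parts.map fun q => [q]) := by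
  classical
  -- Nothing is lost by summing over compositions of `A` only, because `eList_supp` confines the
  -- support to them.
  have h1 : eList F Q.parts = ∑ P : Comp A, Finsupp.single P.val (eList F Q.parts P.val) := by
    ext R
    rw [Finsupp.finsetSum_apply]
    by_cases hR : R.supp = A
    · refine Eq.symm (Eq.trans (Finset.sum_eq_single (⟨R, hR⟩ : Comp A) ?_ ?_) ?_)
      · intro P _ hP
        exact Finsupp.single_eq_of_ne fun h => hP (Subtype.ext h.symm)
      · exact fun h => absurd (@Finset.mem_univ (Comp A) _ _) h
      · exact Finsupp.single_eq_same
    · refine Eq.trans ?_ (Finset.sum_eq_zero fun P _ => ?_).symm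
      · by_contra hne
        exact hR ((eList_supp F _ R hne).trans Q.2)
      · exact Finsupp.single_eq_of_ne fun h => hR (h ▸ P.2)
  have h2 := scToWords_eList (F := F) Q.val.disjoint
  have h3 : eList F Q.val.parts = eList F Q.parts := rfl
  rw [h3, h1, map_sum] at h2
  rw [e, map_sum, brackets, List.map_map]
  refine Eq.trans (Finset.sum_congr rfl fun P _ => ?_) (h2.trans ?_)
  · rw [toWords_single, scToWords_single]
    rfl
  · rfl

/-! ### Set compositions and lists of lists -/

namespace Comp

theorem pairwise_disjoint_parts (P : Comp A) : P.parts.Pairwise Disjoint := P.val.disjoint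

theorem nodup_parts (P : Comp A) : P.parts.Nodup := by
  refine P.val.disjoint.imp_of_mem ?_
  rintro a b ha - hab rfl
  exact (P.val.nonempty a ha).ne_empty (disjoint_self.1 hab)

theorem exists_mem_of_mem (P : Comp A) {a : ℕ+} (ha : a ∈ A) : ∃ p ∈ P.parts, a ∈ p := by
  have h : unionL P.parts = A := P.2
  rw [← h] at ha
  exact mem_unionL.1 ha

theorem eq_of_subset {P : Comp A} {p q r : Finset ℕ+} (hp : p ∈ P.parts) (hq : q ∈ P.parts)
    (hr : r.Nonempty) (hrp : r ⊆ p) (hrq : r ⊆ q) : p = q := by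
  obtain ⟨a, ha⟩ := hr
  exact eq_of_mem_of_mem P.val.disjoint hp hq (hrp ha) (hrq ha)

theorem Refines.refl (P : Comp A) : P.Refines P := fun p hp => ⟨p, hp, le_rfl⟩

theorem Refines.trans {P Q R : Comp A} (h : P.Refines Q) (h' : Q.Refines R) : P.Refines R := by
  intro p hp
  obtain ⟨q, hq, hpq⟩ := h p hp
  obtain ⟨r, hr, hqr⟩ := h' q hq
  exact ⟨r, hr, hpq.trans hqr⟩

theorem Refines.mem {P Q : Comp A} (h : P.Refines Q) (h' : Q.Refines P) {p : Finset ℕ+}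
    (hp : p ∈ P.parts) : p ∈ Q.parts := by
  obtain ⟨q, hq, hpq⟩ := h p hp
  obtain ⟨p', hp', hqp⟩ := h' q hq
  have := eq_of_subset hp hp' (P.val.nonempty p hp) le_rfl (hpq.trans hqp)
  subst this
  rwa [hpq.antisymm hqp]

theorem Refines.perm {P Q : Comp A} (h : P.Refines Q) (h' : Q.Refines P) :
    P.parts.Perm Q.parts :=
  (List.perm_ext_iff_of_nodup P.nodup_parts Q.nodup_parts).2 fun _ =>
    ⟨fun hp => h.mem h' hp, fun hp => h'.mem h hp⟩

theorem mul_refines_left (P Q : Comp A) : (P * Q).Refines P := by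
  intro r hr
  rw [parts_mul] at hr
  obtain ⟨p, hp, hr⟩ := List.mem_flatMap.1 (List.mem_filter.1 hr).1
  obtain ⟨q, -, rfl⟩ := List.mem_map.1 hr
  exact ⟨p, hp, Finset.inter_subset_left⟩

/-- `U` is an arrangement of the components of `Q` in non-empty lists. -/
def Grouping (Q : Comp A) (U : List (List (Finset ℕ+))) : Prop :=
  U.flatten.Perm Q.parts ∧ [] ∉ U

namespace Grouping

variable {Q : Comp A} {U V : List (List (Finset ℕ+))}

theorem perm (h : Q.Grouping U) (hV : V.Perm U) : Q.Grouping V :=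
  ⟨hV.flatten.trans h.1, fun hm => h.2 (hV.mem_iff.1 hm)⟩

theorem mem_parts (h : Q.Grouping U) {u : List (Finset ℕ+)} (hu : u ∈ U) {q : Finset ℕ+}
    (hq : q ∈ u) : q ∈ Q.parts :=
  h.1.mem_iff.1 (List.mem_flatten.2 ⟨u, hu, hq⟩)

theorem ne_nil (h : Q.Grouping U) {u : List (Finset ℕ+)} (hu : u ∈ U) : u ≠ [] := by
  rintro rfl
  exact h.2 hu

theorem pairwise_flatten (h : Q.Grouping U) : U.flatten.Pairwise Disjoint :=
  (h.1.pairwise_iff fun h => h.symm).2 Q.val.disjoint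

/-- Attaches to a product of brackets the composition whose character gives its eigenvalues and
whose length is the number of brackets. -/
theorem exists_comp (h : Q.Grouping U) : ∃ P : Comp A, P.parts = U.map unionL := by
  refine ⟨⟨⟨U.map unionL, ?_, ?_⟩, ?_⟩, rfl⟩
  · intro p hp
    obtain ⟨u, hu, rfl⟩ := List.mem_map.1 hp
    obtain ⟨q, hq⟩ := List.exists_mem_of_ne_nil _ (h.ne_nil hu)
    obtain ⟨a, ha⟩ := Q.val.nonempty q (h.mem_parts hu hq)
    exact ⟨a, mem_unionL.2 ⟨q, hq, ha⟩⟩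
  · rw [List.pairwise_map]
    refine (List.pairwise_flatten.1 h.pairwise_flatten).2.imp fun {u v} huv => ?_
    rw [Finset.disjoint_left]
    intro a hau hav
    obtain ⟨q, hq, haq⟩ := mem_unionL.1 hau
    obtain ⟨r, hr, har⟩ := mem_unionL.1 hav
    exact Finset.disjoint_left.1 (huv q hq r hr) haq har
  · have hQ : unionL Q.parts = A := Q.2
    refine Eq.trans ?_ hQ
    ext a
    simp only [SetComp.supp, mem_unionL, List.mem_map, exists_exists_and_eq_and]
    constructor
    · rintro ⟨u, hu, q, hq, ha⟩
      exact ⟨q, h.mem_parts hu hq, ha⟩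
    · rintro ⟨q, hq, ha⟩
      obtain ⟨u, hu, hqu⟩ := List.mem_flatten.1 (h.1.mem_iff.2 hq)
      exact ⟨u, hu, q, hqu, ha⟩

theorem singletons (Q : Comp A) : Q.Grouping (Q.parts.map fun q => [q]) := by
  refine ⟨?_, by simp⟩
  rw [← List.flatMap_def, List.flatMap_singleton']

end Grouping

end Comp

open SolomonTits.Comp

theorem unionL_subset_iff {u : List (Finset ℕ+)} {p : Finset ℕ+} :
    unionL u ⊆ p ↔ ∀ q ∈ u, q ⊆ p := by
  constructor
  · intro h q hq a ha
    exact h (mem_unionL.2 ⟨q, hq, ha⟩)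
  · intro h a ha
    obtain ⟨q, hq, haq⟩ := mem_unionL.1 ha
    exact h q hq haq

-- The action of set compositions on products of brackets

section Action

variable {Q T P : Comp A} {U V : List (List (Finset ℕ+))}

theorem act_brackets_of_not_refines (hU : Q.Grouping U) (hT : T.parts = U.map unionL)
    (h : ¬ T.Refines P) : act F P.parts (brackets F U) = 0 := by
  simp only [Refines, hT, List.forall_mem_map, not_forall] at h
  obtain ⟨u, hu, hP⟩ := h
  refine act_brackets_eq_zero P.pairwise_disjoint_parts hu (hU.ne_nil hu) (fun q hq => ?_) ?_
  · have hq' := hU.mem_parts hu hq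
    have hPA : unionL P.parts = A := P.2
    refine ⟨Q.val.nonempty q hq', ?_⟩
    rw [hPA]
    exact subset_of_mem hq'
  · simpa only [unionL_subset_iff] using hP

theorem exists_perm_act_brackets (hT : T.parts = U.map unionL) (h : T.Refines P) :
    ∃ V, V.Perm U ∧ act F P.parts (brackets F U) = brackets F V := by
  have h1 : ∀ u ∈ U, ∃ p ∈ P.parts, ∀ q ∈ u, q ⊆ p := by
    simpa only [Refines, hT, List.forall_mem_map, unionL_subset_iff] using h
  choose! c hc using h1
  exact ⟨_, flatMap_filter_perm P.nodup_parts c fun u hu => (hc u hu).1,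
    act_brackets P.pairwise_disjoint_parts P.nodup_parts c hc⟩

theorem filter_map_eq_singleton {ι κ : Type*} [DecidableEq κ] {f : ι → κ} {l : List ι}
    (h : (l.map f).Nodup) {i : ι} (hi : i ∈ l) : (l.filter fun j => f j = f i) = [i] := by
  induction l with
  | nil => exact absurd hi List.not_mem_nil
  | cons j l ih =>
    rw [List.map_cons, List.nodup_cons] at h
    rcases List.mem_cons.1 hi with rfl | hi
    · rw [List.filter_cons_of_pos (by simp), List.filter_eq_nil_iff.2]
      intro k hk hki
      exact h.1 (List.mem_map.2 ⟨k, hk, by simpa using hki⟩)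
    · rw [List.filter_cons_of_neg, ih h.2 hi]
      simp only [decide_eq_true_eq]
      intro hji
      exact h.1 (List.mem_map.2 ⟨i, hi, hji.symm⟩)

/-- Each component of `P` contains exactly one bracket, so sorting by components yields the order of
`V`. Every reordering of a product is thus realised by the algebra. -/
theorem act_brackets_of_parts_eq (hVU : V.Perm U)
    (hP : P.parts = V.map unionL) : act F P.parts (brackets F U) = brackets F V := by
  have hn : (V.map unionL).Nodup := hP ▸ P.nodup_parts
  rw [act_brackets P.pairwise_disjoint_parts P.nodup_parts unionL fun u hu => ⟨?_, ?_⟩]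
  · rw [hP, List.flatMap_map]
    congr 1
    have h1 : ∀ v ∈ V, (U.filter fun u => unionL u = unionL v) = [v] := by
      intro v hv
      have h2 := hVU.filter fun u => decide (unionL u = unionL v)
      rw [filter_map_eq_singleton hn hv] at h2
      exact List.perm_singleton.1 h2.symm
    have h3 : (V.flatMap fun v => U.filter fun u => unionL u = unionL v) =
        V.flatMap fun v => [v] := by
      simp only [List.flatMap]
      rw [List.map_congr_left h1]
    rw [h3, List.flatMap_singleton']
  · rw [hP]
    exact List.mem_map.2 ⟨u, hVU.mem_iff.2 hu, rfl⟩
  · exact unionL_subset_iff.1 le_rfl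

variable (F) in
open Classical in
/-- The value of the character of the Solomon-Tits algebra that belongs to `T` at `P`. -/
def charValue (T P : Comp A) : F := if T.Refines P then 1 else 0

theorem charValue_of_refines (h : T.Refines P) : charValue F T P = 1 := if_pos h

theorem charValue_of_not_refines (h : ¬ T.Refines P) : charValue F T P = 0 := if_neg h

theorem charValue_congr {P P' : Comp A} (h : P.parts.Perm P'.parts) :
    charValue F T P = charValue F T P' := by
  have h1 : T.Refines P ↔ T.Refines P' := by
    simp only [Refines, h.mem_iff]
  by_cases hP : T.Refines P
  · rw [charValue_of_refines hP, charValue_of_refines (h1.1 hP)]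
  · rw [charValue_of_not_refines hP, charValue_of_not_refines fun h2 => hP (h1.2 h2)]

/-- Either `P` permutes the brackets, which is harmless modulo fewer brackets, or it splits one of
them and annihilates the product. -/
theorem act_brackets_sub_mem (hU : Q.Grouping U) (hT : T.parts = U.map unionL) (P : Comp A) :
    act F P.parts (brackets F U) - charValue F T P • brackets F U ∈
      fewBrackets F Q.parts U.length := by
  by_cases h : T.Refines P
  · obtain ⟨V, hV, hact⟩ := exists_perm_act_brackets (F := F) hT h
    rw [hact, charValue_of_refines h, one_smul, ← hV.length_eq]
    exact fewBrackets_perm (hU.perm hV).1 _ (brackets_sub_brackets_mem hV (hU.perm hV).2)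
  · rw [act_brackets_of_not_refines hU hT h, charValue_of_not_refines h, zero_smul,
      sub_zero]
    exact zero_mem _

theorem act_mem_fewBrackets (P : Comp A) {n : ℕ} {x : WAlg F}
    (hx : x ∈ fewBrackets F Q.parts n) : act F P.parts x ∈ fewBrackets F Q.parts n := by
  induction hx using Submodule.span_induction with
  | mem x hx =>
    obtain ⟨U, h1, h2, h3, rfl⟩ := hx
    obtain ⟨T, hT⟩ := Grouping.exists_comp ⟨h1, h2⟩
    have h := fewBrackets_mono _ h3.le (act_brackets_sub_mem (F := F) ⟨h1, h2⟩ hT P)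
    have h4 := Submodule.smul_mem _ (charValue F T P)
      (brackets_mem_fewBrackets (F := F) h1 h2 h3)
    exact (Submodule.sub_mem_iff_left _ h4).1 h
  | zero => simp
  | add x y _ _ hx hy =>
    rw [map_add]
    exact add_mem hx hy
  | smul r x _ hx =>
    rw [map_smul]
    exact Submodule.smul_mem _ r hx

end Action

end

end SolomonTits


namespace SolomonTits

noncomputable section

open SolomonTits.Comp

variable {F : Type*} [Field F] {A : Finset ℕ+} {Q T P : Comp A}

/-! ### The radical series -/

theorem length_le_length_flatten {ι : Type*} {U : List (List ι)} (hU : [] ∉ U) :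
    U.length ≤ U.flatten.length := by
  induction U with
  | nil => simp
  | cons u U ih =>
    simp only [List.mem_cons, not_or] at hU
    have h1 := List.length_pos_of_ne_nil (Ne.symm hU.1)
    have h2 := ih hU.2
    simp only [List.length_cons, List.flatten_cons, List.length_append]
    omega

theorem eq_map_singleton_or_exists_append {ι : Type*} {U : List (List ι)} (hU : [] ∉ U) :
    U = U.flatten.map (fun q => [q]) ∨
      ∃ V x u W, u ≠ [] ∧ U = V ++ (x :: u) :: W := by
  induction U with
  | nil => simp
  | cons u U ih =>
    simp only [List.mem_cons, not_or] at hU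
    rcases u with _ | ⟨x, u⟩
    · exact absurd rfl hU.1
    · by_cases hu : u = []
      · subst hu
        rcases ih hU.2 with h | ⟨V, x', u', W, hu', rfl⟩
        · left
          conv_lhs => rw [h]
          simp
        · right
          exact ⟨[x] :: V, x', u', W, hu', rfl⟩
      · right
        exact ⟨[], x, u, U, hu, rfl⟩

/-- Having fewer brackets than components forces a bracket `[e_x, b]` of length at least two. Its
two terms are the orderings of the separate factors `e_x` and `b`; `P` and `P'` list the unions in
these two orders. -/
theorem exists_brackets_eq_sub {U : List (List (Finset ℕ+))} (hU : Q.Grouping U)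
    (h : U.length < Q.length) : ∃ (P P' : Comp A) (V : List (List (Finset ℕ+))),
      P.parts.Perm P'.parts ∧ Q.Grouping V ∧ V.length = U.length + 1 ∧
      brackets F U = act F P.parts (brackets F V) - act F P'.parts (brackets F V) := by
  rcases eq_map_singleton_or_exists_append hU.2 with hs | ⟨V, x, u, W, hu, rfl⟩
  · have h1 := congrArg List.length hs
    rw [List.length_map, hU.1.length_eq] at h1
    have h2 : Q.length = Q.parts.length := rfl
    omega
  · have hV : Q.Grouping (V ++ [x] :: u :: W) := by
      refine ⟨?_, ?_⟩
      · simpa using hU.1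
      · have := hU.2
        simp only [List.mem_append, List.mem_cons, not_or] at this ⊢
        exact ⟨this.1, by simp, Ne.symm hu, this.2.2⟩
    have hp : (V ++ u :: [x] :: W).Perm (V ++ [x] :: u :: W) :=
      (List.Perm.swap [x] u W).append_left V
    obtain ⟨P, hP⟩ := hV.exists_comp
    obtain ⟨P', hP'⟩ := (hV.perm hp).exists_comp
    refine ⟨P, P', _, ?_, hV, by simp; omega, ?_⟩
    · rw [hP, hP']
      exact (hp.map _).symm
    · rw [act_brackets_of_parts_eq (List.Perm.refl _) hP, act_brackets_of_parts_eq hp hP']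
      simp only [brackets_append, brackets_cons, bracket_cons x hu, bracket_singleton]
      rw [← mul_sub]
      simp only [sub_mul, mul_assoc]

variable {R M : Type*} [Ring R] [Algebra F R] [AddCommGroup M] [Module R M] [Module F M]
  [IsScalarTower F R M]

/-- The module `M` over an algebra spanned by elements `s P` is modelled by the linear map `w` on
words in such a way that `s P` acts by intersection, and is generated by the element that
corresponds to `e_Q`. -/
structure WordModel (Q : Comp A) (s : Comp A → R) (w : M →ₗ[F] WAlg F) : Prop where
  span_range : Submodule.span F (Set.range s) = ⊤
  injective : Function.Injective w
  map_smul : ∀ P x, w (s P • x) = act F P.parts (w x)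
  generator : ∃ m, Submodule.span R {m} = ⊤ ∧ w m = brackets F (Q.parts.map fun q => [q])

namespace WordModel

variable {s : Comp A → R} {w : M →ₗ[F] WAlg F} (h : WordModel Q s w)

include h

omit [IsScalarTower F R M] in
theorem smul_induction {p : R → Prop} (a : R) (h0 : p 0) (hadd : ∀ a b, p a → p b → p (a + b))
    (hs : ∀ (c : F) P, p (c • s P)) : p a := by
  have ha : a ∈ Submodule.span F (Set.range s) := h.span_range ▸ Submodule.mem_top
  obtain ⟨l, rfl⟩ := (Finsupp.mem_span_range_iff_exists_finsupp).1 ha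
  exact Finset.sum_induction _ p hadd h0 fun P _ => hs _ P

omit [IsScalarTower F R M] in
-- Descending induction on the number of brackets: with `ℓ(Q)` brackets all are single letters, and
-- the product is a reordering of the generator; with fewer, `exists_brackets_eq_sub` applies.
theorem exists_eq {U : List (List (Finset ℕ+))} (hU : Q.Grouping U) :
    ∃ y, w y = brackets F U := by
  induction hn : Q.length - U.length generalizing U with
  | zero =>
    rcases eq_map_singleton_or_exists_append hU.2 with hs | ⟨V, x, u, W, hu, rfl⟩
    · obtain ⟨P, hP⟩ := hU.exists_comp
      obtain ⟨m, -, hm⟩ := h.generator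
      refine ⟨s P • m, ?_⟩
      rw [h.map_smul, hm]
      refine act_brackets_of_parts_eq ?_ hP
      rw [hs]
      exact hU.1.map _
    -- All groups are nonempty and one has at least two members, so there are fewer groups than
    -- components, against `hn`.
    · exfalso
      have hU' := hU.2
      simp only [List.mem_append, List.mem_cons, not_or] at hU'
      have h1 := length_le_length_flatten hU'.1
      have h2 := length_le_length_flatten hU'.2.2
      have h3 := hU.1.length_eq
      have h4 : Q.length = Q.parts.length := rfl
      have h5 := List.length_pos_of_ne_nil hu
      simp only [List.flatten_append, List.flatten_cons, List.length_append, List.length_cons]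
        at h3 hn
      omega
  | succ n ih =>
    obtain ⟨P, P', V, -, hV, hl, hact⟩ := exists_brackets_eq_sub (F := F) hU (by omega)
    obtain ⟨y, hyV⟩ := ih hV (by omega)
    refine ⟨s P • y - s P' • y, ?_⟩
    rw [map_sub, h.map_smul, h.map_smul, hyV, hact]

/-- The filtration by the number of brackets. -/
def filtration (n : ℕ) : Submodule R M where
  carrier := {x | w x ∈ fewBrackets F Q.parts n}
  add_mem' {x y} hx hy := by
    simp only [Set.mem_ofPred_eq] at hx hy ⊢
    rw [map_add]
    exact add_mem hx hy
  zero_mem' := by simp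
  smul_mem' a x hx := by
    simp only [Set.mem_ofPred_eq] at hx ⊢
    refine h.smul_induction (p := fun a => w (a • x) ∈ fewBrackets F Q.parts n) a (by simp)
      (fun a b ha hb => ?_) fun c P => ?_
    · rw [add_smul, map_add]
      exact add_mem ha hb
    · rw [smul_assoc, _root_.map_smul, h.map_smul]
      exact Submodule.smul_mem _ c (act_mem_fewBrackets P hx)

theorem mem_filtration {n : ℕ} {x : M} :
    x ∈ h.filtration n ↔ w x ∈ fewBrackets F Q.parts n := Iff.rfl

theorem filtration_zero : h.filtration 0 = ⊥ := by
  rw [eq_bot_iff]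
  intro x hx
  rw [mem_filtration, fewBrackets] at hx
  simp only [Nat.not_lt_zero, false_and, and_false, exists_false] at hx
  have h1 : w x = 0 := by simpa using hx
  exact h.injective (by simpa using h1)

theorem filtration_mono : Monotone h.filtration :=
  fun _ _ hmn _ hx => fewBrackets_mono _ hmn hx

/-- The shift by one comes from the strict inequality in `fewBrackets`: the generator has exactly
`ℓ(Q)` brackets. -/
theorem filtration_length_succ : h.filtration (Q.length + 1) = ⊤ := by
  obtain ⟨m, hm, hwm⟩ := h.generator
  rw [eq_top_iff, ← hm, Submodule.span_singleton_le_iff_mem, mem_filtration, hwm]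
  exact brackets_mem_fewBrackets (Grouping.singletons Q).1 (Grouping.singletons Q).2
    (by simp [Comp.length, Comp.parts, SetComp.length])

theorem smul_sub_charValue_smul_mem {U : List (List (Finset ℕ+))} (hU : Q.Grouping U)
    (hT : T.parts = U.map unionL) {x : M} (hx : w x = brackets F U) (P : Comp A) :
    s P • x - charValue F T P • x ∈ h.filtration U.length := by
  rw [mem_filtration, map_sub, h.map_smul, _root_.map_smul, hx]
  exact act_brackets_sub_mem hU hT P

/-- Compositions with the same components have the same eigenvalues on the layers, so their
difference is zero there. -/
theorem sub_smul_mem_filtration {P P' : Comp A} (hP : P.parts.Perm P'.parts) {n : ℕ}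
    {x : M} (hx : x ∈ h.filtration (n + 1)) : (s P - s P') • x ∈ h.filtration n := by
  rw [mem_filtration, sub_smul, map_sub, h.map_smul, h.map_smul]
  rw [mem_filtration] at hx
  generalize w x = y at hx
  induction hx using Submodule.span_induction with
  | mem y hy =>
    obtain ⟨U, h1, h2, h3, rfl⟩ := hy
    obtain ⟨T, hT⟩ := Grouping.exists_comp ⟨h1, h2⟩
    have h4 := sub_mem (act_brackets_sub_mem (F := F) ⟨h1, h2⟩ hT P)
      (act_brackets_sub_mem (F := F) ⟨h1, h2⟩ hT P')
    rw [charValue_congr hP, sub_sub_sub_cancel_right] at h4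
    exact fewBrackets_mono _ (by omega) h4
  | zero => simp
  | add x y _ _ hx hy =>
    rw [map_add, map_add, add_sub_add_comm]
    exact add_mem hx hy
  | smul r x _ hx =>
    rw [_root_.map_smul, _root_.map_smul, ← smul_sub]
    exact Submodule.smul_mem _ r hx

theorem filtration_le_span {n : ℕ} (hn : n ≤ Q.length) :
    h.filtration n ≤ Submodule.span R {y | ∃ d ∈ {d : R | ∃ P P' : Comp A,
      P.parts.Perm P'.parts ∧ d = s P - s P'}, ∃ x ∈ h.filtration (n + 1), y = d • x} := by
  have key : ∀ ξ ∈ fewBrackets F Q.parts n, ∃ y ∈ Submodule.span R {y | ∃ d ∈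
      {d : R | ∃ P P' : Comp A, P.parts.Perm P'.parts ∧ d = s P - s P'},
        ∃ x ∈ h.filtration (n + 1), y = d • x}, w y = ξ := by
    intro ξ hξ
    induction hξ using Submodule.span_induction with
    | mem ξ hξ =>
      obtain ⟨U, h1, h2, h3, rfl⟩ := hξ
      obtain ⟨P, P', V, hP, hV, hl, hact⟩ :=
        exists_brackets_eq_sub (F := F) ⟨h1, h2⟩ (h3.trans_le hn)
      obtain ⟨y, hyV⟩ := h.exists_eq hV
      refine ⟨(s P - s P') • y,
        Submodule.subset_span ⟨_, ⟨P, P', hP, rfl⟩, y, ?_, rfl⟩, ?_⟩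
      · rw [mem_filtration, hyV]
        exact brackets_mem_fewBrackets hV.1 hV.2 (by omega)
      · rw [sub_smul, map_sub, h.map_smul, h.map_smul, hyV, hact]
    | zero => exact ⟨0, zero_mem _, map_zero w⟩
    | add ξ η _ _ hξ hη =>
      obtain ⟨y, hy, rfl⟩ := hξ
      obtain ⟨z, hz, rfl⟩ := hη
      exact ⟨y + z, add_mem hy hz, map_add w y z⟩
    | smul r ξ _ hξ =>
      obtain ⟨y, hy, rfl⟩ := hξ
      exact ⟨r • y, scalar_smul_mem _ r hy, _root_.map_smul w r y⟩
  intro x hx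
  obtain ⟨y, hy, hyx⟩ := key _ hx
  rwa [← h.injective hyx]

/-- The layers of the filtration are spanned by eigenvectors. -/
theorem exists_span_eigen (n : ℕ) :
    ∃ X : Set (h.filtration (n + 1) ⧸ (h.filtration n).submoduleOf (h.filtration (n + 1))),
      Submodule.span F X = ⊤ ∧ ∀ x ∈ X, ∃ T : Comp A,
        (∀ P, s P • x = charValue F T P • x) ∧ Q.Refines T ∧ T.length = n := by
  let N := (h.filtration n).submoduleOf (h.filtration (n + 1))
  let X : Set (h.filtration (n + 1) ⧸ N) :=
    {x | ∃ (U : List (List (Finset ℕ+))) (y : h.filtration (n + 1)), Q.Grouping U ∧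
      U.length = n ∧ w y = brackets F U ∧ x = N.mkQ y}
  have hmkQ : ∀ (c : F) (y : h.filtration (n + 1)), N.mkQ (c • y) = c • N.mkQ y :=
    fun _ _ => rfl
  refine ⟨X, ?_, ?_⟩
  · have key : ∀ ξ ∈ fewBrackets F Q.parts (n + 1), ∃ y : h.filtration (n + 1),
        w y = ξ ∧ N.mkQ y ∈ Submodule.span F X := by
      intro ξ hξ
      induction hξ using Submodule.span_induction with
      | mem ξ hξ =>
        obtain ⟨U, h1, h2, h3, rfl⟩ := hξ
        obtain ⟨y, hyU⟩ := h.exists_eq ⟨h1, h2⟩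
        have hy' : y ∈ h.filtration (n + 1) := by
          rw [mem_filtration, hyU]
          exact brackets_mem_fewBrackets h1 h2 h3
        refine ⟨⟨y, hy'⟩, hyU, ?_⟩
        by_cases hn : U.length = n
        · exact Submodule.subset_span ⟨U, _, ⟨h1, h2⟩, hn, hyU, rfl⟩
        · have h0 : N.mkQ ⟨y, hy'⟩ = 0 := by
            rw [Submodule.mkQ_apply, Submodule.Quotient.mk_eq_zero]
            change y ∈ h.filtration n
            rw [mem_filtration, hyU]
            exact brackets_mem_fewBrackets h1 h2 (by omega)
          rw [h0]
          exact zero_mem _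
      | zero => exact ⟨0, map_zero w, by rw [map_zero]; exact zero_mem _⟩
      | add ξ η _ _ hξ hη =>
        obtain ⟨y, rfl, hy⟩ := hξ
        obtain ⟨z, rfl, hz⟩ := hη
        exact ⟨y + z, map_add w (y : M) z, by rw [map_add]; exact add_mem hy hz⟩
      | smul r ξ _ hξ =>
        obtain ⟨y, rfl, hy⟩ := hξ
        exact ⟨r • y, _root_.map_smul w r (y : M), by rw [hmkQ]; exact Submodule.smul_mem _ r hy⟩
    rw [eq_top_iff]
    intro z _
    obtain ⟨x, rfl⟩ := N.mkQ_surjective z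
    obtain ⟨y, hy, hyX⟩ := key _ x.2
    have hyx : y = x := Subtype.ext (h.injective hy)
    rwa [← hyx]
  · rintro _ ⟨U, y, hU, hn, hyU, rfl⟩
    obtain ⟨T, hT⟩ := hU.exists_comp
    refine ⟨T, fun P => ?_, ?_, ?_⟩
    · have h1 := h.smul_sub_charValue_smul_mem hU hT hyU P
      have h2 : N.mkQ (s P • y - charValue F T P • y) = 0 := by
        rw [Submodule.mkQ_apply, Submodule.Quotient.mk_eq_zero]
        change s P • (y : M) - charValue F T P • (y : M) ∈ h.filtration n
        exact hn ▸ h1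
      rwa [map_sub, _root_.map_smul, hmkQ, sub_eq_zero] at h2
    · intro q hq
      obtain ⟨u, hu, hqu⟩ := List.mem_flatten.1 (hU.1.mem_iff.2 hq)
      exact ⟨unionL u, hT ▸ List.mem_map.2 ⟨u, hu, rfl⟩, unionL_subset_iff.1 le_rfl q hqu⟩
    · have h1 : T.length = T.parts.length := rfl
      rw [h1, hT, List.length_map, hn]

omit [IsScalarTower F R M] in
theorem isSemisimpleModule_of_span_charValue {L : Type*} [AddCommGroup L] [Module R L]
    [Module F L] [IsScalarTower F R L] {X : Set L} (hX : Submodule.span F X = ⊤)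
    (hXe : ∀ x ∈ X, ∃ T : Comp A, ∀ P, s P • x = charValue F T P • x) :
    IsSemisimpleModule R L := by
  refine isSemisimpleModule_of_span_eigen F (X := X) (fun x hx a => ?_) ?_
  · obtain ⟨T, hT⟩ := hXe x hx
    refine h.smul_induction (p := fun a => ∃ c : F, a • x = c • x) a ⟨0, by simp⟩ ?_ ?_
    · rintro a b ⟨c, hc⟩ ⟨d, hd⟩
      exact ⟨c + d, by rw [add_smul, add_smul, hc, hd]⟩
    · intro c P
      exact ⟨c * charValue F T P, by rw [smul_assoc, hT, mul_smul]⟩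
  · rw [eq_top_iff]
    intro x _
    have hx : x ∈ Submodule.span F X := hX ▸ Submodule.mem_top
    exact Submodule.span_le_restrictScalars F R X hx

/-- One inclusion holds because the layer is semisimple, the other by the chain argument applied to
the differences of rearranged compositions. -/
theorem map_jacobson_filtration {n : ℕ} (hn : n ≤ Q.length) :
    (Module.jacobson R (h.filtration (n + 1))).map (h.filtration (n + 1)).subtype =
      h.filtration n := by
  refine le_antisymm ?_ ?_
  · obtain ⟨X, hX, hXe⟩ := h.exists_span_eigen n
    have := h.isSemisimpleModule_of_span_charValue hX fun x hx =>
      (hXe x hx).imp fun _ hT => hT.1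
    exact map_jacobson_le_of_isSemisimpleModule
  · refine le_map_jacobson_of_chain _ h.filtration h.filtration_zero h.filtration_mono
      ?_ n (h.filtration_le_span hn)
    rintro i _ ⟨P, P', hP, rfl⟩ x hx
    exact h.sub_smul_mem_filtration hP hx

theorem radSeries_eq (k : ℕ) : radSeries R M k = h.filtration (Q.length + 1 - k) := by
  induction k with
  | zero => rw [Nat.sub_zero, filtration_length_succ, radSeries]
  | succ k ih =>
    -- The type of the radical depends on the submodule, so the equality is generalised before it is
    -- substituted.
    have h1 : ∀ N : Submodule R M, radSeries R M k = N →
        radSeries R M (k + 1) = (Module.jacobson R N).map N.subtype := by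
      rintro _ rfl
      rfl
    rw [h1 _ ih]
    by_cases hk : k ≤ Q.length
    · rw [show Q.length + 1 - k = (Q.length - k) + 1 by omega,
        h.map_jacobson_filtration (by omega)]
      congr 1
      omega
    -- Beyond `ℓ(Q)` the truncated subtraction gives 0, matching a radical series that has reached
    -- zero.
    · rw [show Q.length + 1 - k = 0 by omega, show Q.length + 1 - (k + 1) = 0 by omega,
        filtration_zero, eq_bot_iff]
      exact Submodule.map_subtype_le _ _

theorem jacobson_eq : Module.jacobson R M = h.filtration Q.length := by
  have h1 : (Module.jacobson R (⊤ : Submodule R M)).map (⊤ : Submodule R M).subtype =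
      Module.jacobson R M :=
    Module.map_jacobson_of_bijective ⟨Subtype.val_injective, fun x => ⟨⟨x, trivial⟩, rfl⟩⟩
  rw [← h1]
  exact h.radSeries_eq 1

theorem exists_span_eigen_loewyLayer (k : ℕ) :
    ∃ X : Set (LoewyLayer R M k), Submodule.span F X = ⊤ ∧ ∀ x ∈ X,
      ∃ T : Comp A, (∀ P, s P • x = charValue F T P • x) ∧ Q.Refines T ∧
        T.length + k = Q.length := by
  have key : ∀ N N' : Submodule R M, N = h.filtration (Q.length + 1 - k) →
      N' = h.filtration (Q.length + 1 - (k + 1)) →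
      ∃ X : Set (N ⧸ N'.submoduleOf N), Submodule.span F X = ⊤ ∧ ∀ x ∈ X,
        ∃ T : Comp A, (∀ P, s P • x = charValue F T P • x) ∧ Q.Refines T ∧
          T.length + k = Q.length := by
    intro N N' hN hN'
    by_cases hk : k ≤ Q.length
    · rw [show Q.length + 1 - k = (Q.length - k) + 1 by omega] at hN
      rw [show Q.length + 1 - (k + 1) = Q.length - k by omega] at hN'
      subst hN hN'
      obtain ⟨X, hX, hXe⟩ := h.exists_span_eigen (Q.length - k)
      refine ⟨X, hX, fun x hx => ?_⟩
      obtain ⟨T, h1, h2, h3⟩ := hXe x hx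
      exact ⟨T, h1, h2, by omega⟩
    · rw [show Q.length + 1 - k = 0 by omega, filtration_zero] at hN
      subst hN
      refine ⟨∅, ?_, fun x hx => absurd hx (Set.notMem_empty x)⟩
      rw [eq_top_iff]
      intro z _
      obtain ⟨x, rfl⟩ := (N'.submoduleOf ⊥).mkQ_surjective z
      rw [Subsingleton.elim x 0, map_zero]
      exact zero_mem _
  exact key _ _ (h.radSeries_eq k) (h.radSeries_eq (k + 1))

end WordModel

end

end SolomonTits


namespace SolomonTits

noncomputable section

open SolomonTits.Comp

variable {F : Type*} [Field F] {A : Finset ℕ+} {Q T P : Comp A}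

theorem charValue_congr_left {T' : Comp A} (h : T.Refines T') (h' : T'.Refines T) (P : Comp A) :
    charValue F T P = charValue F T' P := by
  by_cases hP : T.Refines P
  · rw [charValue_of_refines hP, charValue_of_refines (h'.trans hP)]
  · rw [charValue_of_not_refines hP, charValue_of_not_refines fun h2 => hP (h.trans h2)]

/-! ### Multiplicities in the radical layers -/

variable {R M : Type*} [Ring R] [Algebra F R] [AddCommGroup M] [Module R M] [Module F M]
  [IsScalarTower F R M]

variable (F) in
/-- `t` is, up to the other elements `s P`, the element `s T` and is annihilated by those `s P` with
`T` not a refinement of `P`. -/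
structure IsPrimitiveFor (T : Comp A) (s : Comp A → R) (t : R) : Prop where
  sub_mem : t - s T ∈ Submodule.span F (s '' {P | ¬ T.Refines P})
  mul_self : s T * t = t
  mul_eq_zero : ∀ P, ¬ T.Refines P → s P * t = 0

namespace IsPrimitiveFor

variable {s : Comp A → R} {t : R} (ht : IsPrimitiveFor F T s t)

include ht

theorem smul_eq {x : M} (hx : ∀ P, ¬ T.Refines P → s P • x = 0) : t • x = s T • x := by
  have key : ∀ a ∈ Submodule.span F (s '' {P | ¬ T.Refines P}), a • x = 0 := by
    intro a ha
    induction ha using Submodule.span_induction with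
    | mem a ha =>
      obtain ⟨P, hP, rfl⟩ := ha
      exact hx P hP
    | zero => exact zero_smul R x
    | add a b _ _ ha hb => rw [add_smul, ha, hb, add_zero]
    | smul c a _ ha => rw [smul_assoc, ha, smul_zero]
  have h := key _ ht.sub_mem
  rwa [sub_smul, sub_eq_zero] at h

/-- The element `t` is itself a vector annihilated by the relevant `s P`, so `t t = s T t = t`. -/
theorem isIdempotentElem : IsIdempotentElem t :=
  (ht.smul_eq (x := t) ht.mul_eq_zero).trans ht.mul_self

theorem smul_eq_self {x : M} (hx : ∀ P, s P • x = charValue F T P • x) : t • x = x := by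
  rw [ht.smul_eq fun P hP => by rw [hx, charValue_of_not_refines hP, zero_smul], hx,
    charValue_of_refines (Refines.refl T), one_smul]

/-- If `T'` does not refine `T`, then `s T` annihilates the line of `x`, and `t = s T t`. If `T`
does not refine `T'`, then `s T'` fixes this line although `s T' t = 0`. -/
theorem smul_eq_zero_or {T' : Comp A} {x : M} (hx : ∀ P, s P • x = charValue F T' P • x)
    (hc : ∃ c : F, t • x = c • x) :
    t • x = 0 ∨ (t • x = x ∧ T'.Refines T ∧ T.Refines T') := by
  obtain ⟨c, hc⟩ := hc
  by_cases h1 : T'.Refines T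
  · by_cases h2 : T.Refines T'
    · refine Or.inr ⟨ht.smul_eq_self fun P => ?_, h1, h2⟩
      rw [hx, charValue_congr_left h1 h2]
    · left
      have h3 : s T' • t • x = t • x := by
        rw [hc, smul_scalar_comm, hx, charValue_of_refines (Refines.refl T'), one_smul]
      rw [← h3, smul_smul, ht.mul_eq_zero _ h2, zero_smul]
  · left
    rw [← ht.mul_self, mul_smul, hc, smul_scalar_comm, hx, charValue_of_not_refines h1, zero_smul,
      smul_zero]

end IsPrimitiveFor

namespace WordModel

-- The one-dimensional head of `Λ_T`

section Top

variable {s : Comp A → R} {w : M →ₗ[F] WAlg F} (h : WordModel T s w)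

include h

omit [IsScalarTower F R M] in
theorem nontrivial : Nontrivial M := by
  obtain ⟨m, -, hm⟩ := h.generator
  refine ⟨m, 0, fun h0 => ?_⟩
  rw [h0, map_zero] at hm
  refine brackets_ne_zero (F := F) T.pairwise_disjoint_parts T.val.nonempty ?_ hm.symm
  intro u hu
  obtain ⟨q, hq, rfl⟩ := List.mem_map.1 hu
  exact ⟨by simp, by simp, by simpa using hq⟩

/-- The vector is the image of the generator. It is nonzero because a nonzero finitely generated
module differs from its radical. -/
theorem exists_generator_top : ∃ x : M ⧸ Module.jacobson R M, x ≠ 0 ∧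
    (∀ P, s P • x = charValue F T P • x) ∧ ∀ y, ∃ c : F, c • x = y := by
  have := h.nontrivial
  obtain ⟨m, hm, hwm⟩ := h.generator
  have hT : T.parts = (T.parts.map fun q => [q]).map unionL := by
    simp [unionL, Function.comp_def]
  have hP : ∀ P, s P • (Module.jacobson R M).mkQ m =
      charValue F T P • (Module.jacobson R M).mkQ m := by
    intro P
    have h1 := h.smul_sub_charValue_smul_mem (Grouping.singletons T) hT hwm P
    rw [List.length_map] at h1
    have h2 : s P • m - charValue F T P • m ∈ Module.jacobson R M := by
      rw [h.jacobson_eq]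
      exact h1
    rw [← Submodule.Quotient.mk_eq_zero, Submodule.Quotient.mk_sub, sub_eq_zero] at h2
    exact h2
  have hgen : ∀ y, ∃ c : F, c • (Module.jacobson R M).mkQ m = y := by
    intro y
    obtain ⟨z, rfl⟩ := (Module.jacobson R M).mkQ_surjective y
    have hz : z ∈ Submodule.span R {m} := hm ▸ Submodule.mem_top
    obtain ⟨a, rfl⟩ := Submodule.mem_span_singleton.1 hz
    rw [_root_.map_smul]
    refine h.smul_induction (p := fun a => ∃ c : F, c • (Module.jacobson R M).mkQ m =
      a • (Module.jacobson R M).mkQ m) a ⟨0, by rw [zero_smul, zero_smul]⟩ ?_ ?_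
    · rintro a b ⟨c, hc⟩ ⟨d, hd⟩
      exact ⟨c + d, by rw [add_smul, add_smul, hc, hd]⟩
    · intro c P
      exact ⟨c * charValue F T P, by rw [smul_assoc, hP, mul_smul]⟩
  refine ⟨(Module.jacobson R M).mkQ m, fun h0 => ?_, hP, hgen⟩
  have : Module.Finite R M := ⟨⟨{m}, by simpa using hm⟩⟩
  refine (Module.jacobson_lt_top R M).ne (eq_top_iff.2 fun x _ => ?_)
  obtain ⟨c, hc⟩ := hgen ((Module.jacobson R M).mkQ x)
  rw [h0, smul_zero] at hc
  exact (Submodule.Quotient.mk_eq_zero _).1 hc.symm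

theorem top_smul_eq (P : Comp A) (y : M ⧸ Module.jacobson R M) :
    s P • y = charValue F T P • y := by
  obtain ⟨x, -, hx, hgen⟩ := h.exists_generator_top
  obtain ⟨c, rfl⟩ := hgen y
  rw [smul_scalar_comm, hx, smul_comm]

theorem finrank_top : Module.finrank F (M ⧸ Module.jacobson R M) = 1 := by
  obtain ⟨x, hx0, -, hgen⟩ := h.exists_generator_top
  exact finrank_eq_one x hx0 hgen

theorem isSimpleModule_top : IsSimpleModule R (M ⧸ Module.jacobson R M) := by
  have : Nontrivial (M ⧸ Module.jacobson R M) :=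
    Module.nontrivial_of_finrank_pos (R := F) (by rw [h.finrank_top]; exact one_pos)
  refine isSimpleModule_iff_toSpanSingleton_surjective.2 ⟨this, fun x hx y => ?_⟩
  obtain ⟨c, rfl⟩ := (finrank_eq_one_iff_of_nonzero' x hx).1 h.finrank_top y
  exact ⟨algebraMap F R c, algebraMap_smul R c x⟩

theorem rankOn_top {t : R} (ht : IsPrimitiveFor F T s t) :
    rankOn F t (M ⧸ Module.jacobson R M) = 1 := by
  have h1 : LinearMap.range (actBy F t (M ⧸ Module.jacobson R M)) = ⊤ := by
    rw [LinearMap.range_eq_top]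
    intro y
    exact ⟨y, ht.smul_eq_self fun P => h.top_smul_eq P y⟩
  rw [rankOn, h1, _root_.finrank_top, h.finrank_top]

theorem exists_character_top : ∃ χ : R → F, (∀ a (y : M ⧸ Module.jacobson R M), a • y = χ a • y) ∧
    ∀ a, ∀ x : M ⧸ Module.jacobson R M, x ≠ 0 → ∀ c : F, a • x = c • x → c = χ a := by
  have h1 : ∀ a : R, ∃ c : F, ∀ y : M ⧸ Module.jacobson R M, a • y = c • y := by
    intro a
    refine h.smul_induction (p := fun a => ∃ c : F, ∀ y : M ⧸ Module.jacobson R M,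
      a • y = c • y) a ⟨0, fun y => by rw [zero_smul, zero_smul]⟩ ?_ ?_
    · rintro a b ⟨c, hc⟩ ⟨d, hd⟩
      exact ⟨c + d, fun y => by rw [add_smul, add_smul, hc, hd]⟩
    · intro c P
      exact ⟨c * charValue F T P, fun y => by rw [smul_assoc, h.top_smul_eq, mul_smul]⟩
  choose χ hχ using h1
  refine ⟨χ, hχ, fun a x hx c hc => ?_⟩
  rw [hχ] at hc
  exact (smul_left_injective F hx hc).symm

end Top

-- The idempotent on the Loewy layers

section Layers

variable {s : Comp A → R} {w : M →ₗ[F] WAlg F} (h : WordModel Q s w) {t : R}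
  (ht : IsPrimitiveFor F T s t)

include h

omit [IsScalarTower F R M] in
theorem exists_smul_eq_smul {T' : Comp A} {L : Type*} [AddCommGroup L] [Module R L] [Module F L]
    [IsScalarTower F R L] {x : L} (hx : ∀ P, s P • x = charValue F T' P • x) (a : R) :
    ∃ c : F, a • x = c • x := by
  refine h.smul_induction (p := fun a => ∃ c : F, a • x = c • x) a
    ⟨0, by rw [zero_smul, zero_smul]⟩ ?_ ?_
  · rintro a b ⟨c, hc⟩ ⟨d, hd⟩
    exact ⟨c + d, by rw [add_smul, add_smul, hc, hd]⟩
  · intro c P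
    exact ⟨c * charValue F T' P, by rw [smul_assoc, hx, mul_smul]⟩

include ht

theorem refines_of_smul_ne_zero {k : ℕ} {x : LoewyLayer R M k} (hx : t • x ≠ 0) :
    Q.Refines T ∧ T.length + k = Q.length := by
  obtain ⟨X, hX, hXe⟩ := h.exists_span_eigen_loewyLayer k
  by_contra hcon
  have key : ∀ x ∈ Submodule.span F X, t • x = 0 := by
    intro x hx
    induction hx using Submodule.span_induction with
    | mem x hx =>
      obtain ⟨T', h1, h2, h3⟩ := hXe x hx
      refine (ht.smul_eq_zero_or h1 (h.exists_smul_eq_smul h1 t)).resolve_right ?_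
      rintro ⟨-, h4, h5⟩
      refine hcon ⟨h2.trans h4, ?_⟩
      have h6 : T.length = T'.length := (h4.perm h5).length_eq.symm
      rw [h6, h3]
    | zero => exact smul_zero t
    | add x y _ _ hx hy => rw [smul_add, hx, hy, add_zero]
    | smul c x _ hx => rw [smul_scalar_comm, hx, smul_zero]
  exact hx (key x (hX ▸ Submodule.mem_top))

omit ht in
-- A layer is spanned by common eigenvectors, so all of `R` acts on it by commuting operators.
theorem smul_comm_layer {k : ℕ} (a : R) (x : LoewyLayer R M k) : t • a • x = a • t • x := by
  obtain ⟨X, hX, hXe⟩ := h.exists_span_eigen_loewyLayer k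
  have hx' : x ∈ Submodule.span F X := hX ▸ Submodule.mem_top
  induction hx' using Submodule.span_induction with
  | mem x hx =>
    obtain ⟨T', h1, -, -⟩ := hXe x hx
    obtain ⟨c, hc⟩ := h.exists_smul_eq_smul h1 a
    obtain ⟨d, hd⟩ := h.exists_smul_eq_smul h1 t
    rw [hc, hd, smul_scalar_comm, smul_scalar_comm, hc, hd, smul_comm]
  | zero => simp only [smul_zero]
  | add x y _ _ hx hy => simp only [smul_add, hx, hy]
  | smul c x _ hx => rw [smul_scalar_comm a, smul_scalar_comm t, hx, smul_scalar_comm t,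
      smul_scalar_comm a]

/-- Spanning eigenvectors not annihilated by `t` belong to the components of `T`, hence share the
character of `y`. -/
theorem smul_smul_layer {S : Type*} [AddCommGroup S] [Module R S] [Module F S]
    [IsScalarTower F R S] {y : S} (hy0 : y ≠ 0) (hy : ∀ P, s P • y = charValue F T P • y)
    {χ : R → F} (hχ : ∀ a : R, a • y = χ a • y) {k : ℕ} (a : R) (x : LoewyLayer R M k) :
    a • t • x = χ a • t • x := by
  obtain ⟨X, hX, hXe⟩ := h.exists_span_eigen_loewyLayer k
  have hx' : x ∈ Submodule.span F X := hX ▸ Submodule.mem_top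
  induction hx' using Submodule.span_induction with
  | mem x hx =>
    obtain ⟨T', h1, -, -⟩ := hXe x hx
    rcases ht.smul_eq_zero_or h1 (h.exists_smul_eq_smul h1 t) with h2 | ⟨h2, h3, h4⟩
    · rw [h2, smul_zero, smul_zero]
    · rw [h2]
      have key : ∃ c : F, a • x = c • x ∧ a • y = c • y := by
        refine h.smul_induction (p := fun a => ∃ c : F, a • x = c • x ∧ a • y = c • y) a
          ⟨0, by rw [zero_smul, zero_smul], by rw [zero_smul, zero_smul]⟩ ?_ ?_
        · rintro a b ⟨c, hc, hc'⟩ ⟨d, hd, hd'⟩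
          exact ⟨c + d, by rw [add_smul, add_smul, hc, hd], by rw [add_smul, add_smul, hc', hd']⟩
        · intro c P
          refine ⟨c * charValue F T P, ?_, by rw [smul_assoc, hy, mul_smul]⟩
          rw [smul_assoc, h1, charValue_congr_left h3 h4, mul_smul]
      obtain ⟨c, hc, hc'⟩ := key
      rw [hχ] at hc'
      rw [hc, smul_left_injective F hy0 hc']
  | zero => simp only [smul_zero]
  | add x y _ _ hx hy => simp only [smul_add, hx, hy]
  | smul c x _ hx => rw [smul_scalar_comm t, smul_scalar_comm a, hx, smul_comm]

/-- Grouping the components of `Q` inside each component of `T` gives a product of brackets with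
tuple of unions `T`. On it `t` acts as `s T`, which preserves the order of the factors, and the
product is nonzero. -/
theorem exists_smul_ne_zero (hQT : Q.Refines T) : ∃ x : M, t • x ≠ 0 := by
  choose! c hc using hQT
  let U := T.parts.map fun p => Q.parts.filter fun q => q ⊆ p
  have hcq : ∀ q ∈ Q.parts, ∀ p ∈ T.parts, q ⊆ p ↔ c q = p := by
    intro q hq p hp
    constructor
    · intro hqp
      exact eq_of_subset (hc q hq).1 hp (Q.val.nonempty q hq) (hc q hq).2 hqp
    · rintro rfl
      exact (hc q hq).2
  have hflat : U.flatten.Perm Q.parts := by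
    have h2 := flatMap_filter_perm T.nodup_parts c fun q hq => (hc q hq).1
    have h3 : U = T.parts.map fun p => Q.parts.filter fun q => c q = p := by
      refine List.map_congr_left fun p hp => List.filter_congr fun q hq => ?_
      simp only [hcq q hq p hp]
    rw [h3]
    exact h2
  have hunion : T.parts = U.map unionL := by
    rw [List.map_map]
    conv_lhs => rw [← List.map_id T.parts]
    refine List.map_congr_left fun p hp => ?_
    ext a
    simp only [id, Function.comp_apply, mem_unionL, List.mem_filter, decide_eq_true_eq]
    constructor
    · intro ha
      obtain ⟨q, hq, haq⟩ := Q.exists_mem_of_mem (subset_of_mem hp ha)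
      have h2 := eq_of_mem_of_mem T.pairwise_disjoint_parts (hc q hq).1 hp ((hc q hq).2 haq) ha
      exact ⟨q, ⟨hq, h2 ▸ (hc q hq).2⟩, haq⟩
    · rintro ⟨q, ⟨-, hqp⟩, ha⟩
      exact hqp ha
  have hU : Q.Grouping U := by
    refine ⟨hflat, fun hnil => ?_⟩
    have h2 : unionL [] ∈ T.parts := hunion ▸ List.mem_map.2 ⟨[], hnil, rfl⟩
    exact (T.val.nonempty _ h2).ne_empty rfl
  obtain ⟨y, hy⟩ := h.exists_eq hU
  refine ⟨y, fun h0 => ?_⟩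
  rw [ht.smul_eq fun P hP => h.injective (by
    rw [h.map_smul, hy, act_brackets_of_not_refines hU hunion hP, map_zero])] at h0
  have h2 := congrArg w h0
  rw [h.map_smul, hy, act_brackets_of_parts_eq (List.Perm.refl _) hunion, map_zero] at h2
  refine brackets_ne_zero Q.pairwise_disjoint_parts Q.val.nonempty (fun u hu => ?_) h2
  refine ⟨hU.ne_nil hu, ?_, fun q hq => hU.mem_parts hu hq⟩
  obtain ⟨p, -, rfl⟩ := List.mem_map.1 hu
  exact Q.nodup_parts.filter _

theorem rankOn_layer_eq_zero [FiniteDimensional F M] {k : ℕ}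
    (hk : ¬ (Q.Refines T ∧ T.length + k = Q.length)) : rankOn F t (LoewyLayer R M k) = 0 := by
  have : FiniteDimensional F (radSeries R M k) :=
    inferInstanceAs (FiniteDimensional F ((radSeries R M k).restrictScalars F))
  rw [rankOn_eq_zero_iff]
  intro x
  by_contra hx
  exact hk (h.refines_of_smul_ne_zero ht hx)

omit h in
theorem rankOn_radSeries [FiniteDimensional F M] (k : ℕ) :
    rankOn F t (radSeries R M k) =
      rankOn F t (radSeries R M (k + 1)) + rankOn F t (LoewyLayer R M k) :=
  rankOn_submodule_eq_add ht.isIdempotentElem (Submodule.map_subtype_le _ _)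

omit h ht in
theorem rankOn_radSeries_zero : rankOn F t (radSeries R M 0) = rankOn F t M :=
  rankOn_congr t Submodule.topEquiv

omit ht in
theorem rankOn_radSeries_length : rankOn F t (radSeries R M (Q.length + 1)) = 0 := by
  rw [h.radSeries_eq, Nat.sub_self, h.filtration_zero]
  exact Module.finrank_zero_of_subsingleton

theorem rankOn_eq_zero_of_not_refines [FiniteDimensional F M] (hQT : ¬ Q.Refines T) :
    rankOn F t M = 0 := by
  have key : ∀ k, rankOn F t (radSeries R M k) = rankOn F t M := by
    intro k
    induction k with
    | zero => exact rankOn_radSeries_zero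
    | succ k ih =>
      rw [← ih, rankOn_radSeries ht k, h.rankOn_layer_eq_zero ht fun h1 => hQT h1.1, add_zero]
  rw [← key (Q.length + 1), h.rankOn_radSeries_length]

theorem rankOn_layer [FiniteDimensional F M] {k : ℕ} (hk : T.length + k = Q.length) :
    rankOn F t (LoewyLayer R M k) = rankOn F t M := by
  -- The rank along the radical series can drop only at layer `k`: up to there it is that of `M`,
  -- and afterwards it is constant and ends at zero.
  have h1 : ∀ j ≤ k, rankOn F t (radSeries R M j) = rankOn F t M := by
    intro j hj
    induction j with
    | zero => exact rankOn_radSeries_zero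
    | succ j ih =>
      rw [← ih (by omega), rankOn_radSeries ht j,
        h.rankOn_layer_eq_zero ht fun h1 => by omega, add_zero]
  have h2 : ∀ j, rankOn F t (radSeries R M (k + 1 + j)) = rankOn F t (radSeries R M (k + 1)) := by
    intro j
    induction j with
    | zero => rfl
    | succ j ih =>
      rw [← ih, rankOn_radSeries ht (k + 1 + j),
        h.rankOn_layer_eq_zero ht fun h1 => by omega, add_zero]
      rfl
  have h3 := h2 (Q.length - k)
  rw [show k + 1 + (Q.length - k) = Q.length + 1 by omega, h.rankOn_radSeries_length] at h3
  rw [← h1 k le_rfl, rankOn_radSeries ht k, ← h3, zero_add]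

end Layers

/-- All claims become claims on `dim tM`: it is the composition multiplicity, it is attained on one
layer, and it is positive exactly when `Q` refines `T`. -/
theorem loewy_multiplicities {s : Comp A → R} {w : M →ₗ[F] WAlg F} (h : WordModel Q s w) {t : R}
    (ht : IsPrimitiveFor F T s t) {v : Submodule.span R {t} →ₗ[F] WAlg F}
    (hT : WordModel T s v) [FiniteDimensional F M] :
    (∀ k : ℕ, OccursAsSummand R (LoewyLayer R M k)
        (Submodule.span R {t} ⧸ Module.jacobson R (Submodule.span R {t})) ↔
        Q.Refines T ∧ (Q.length : ℤ) - (T.length : ℤ) = k) ∧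
    (∀ k : ℕ, Q.Refines T → (Q.length : ℤ) - (T.length : ℤ) = k →
      HasSummandMultiplicity R (LoewyLayer R M k)
        (Submodule.span R {t} ⧸ Module.jacobson R (Submodule.span R {t}))
        (compMultiplicity R M
          (Submodule.span R {t} ⧸ Module.jacobson R (Submodule.span R {t})))) ∧
    (0 < compMultiplicity R M
        (Submodule.span R {t} ⧸ Module.jacobson R (Submodule.span R {t})) ↔ Q.Refines T) := by
  have := hT.isSimpleModule_top
  have hfin : ∀ k, FiniteDimensional F (radSeries R M k) := fun k =>
    inferInstanceAs (FiniteDimensional F ((radSeries R M k).restrictScalars F))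
  rw [compMultiplicity_eq_rankOn ht.isIdempotentElem (hT.rankOn_top ht)]
  have hpos : 0 < rankOn F t M ↔ Q.Refines T := by
    constructor
    · intro h0
      by_contra hQT
      exact h0.ne' (h.rankOn_eq_zero_of_not_refines ht hQT)
    · intro hQT
      rw [Nat.pos_iff_ne_zero, Ne, rankOn_eq_zero_iff]
      obtain ⟨x, hx⟩ := h.exists_smul_ne_zero ht hQT
      exact fun h0 => hx (h0 x)
  obtain ⟨χ, hχ, hχu⟩ := hT.exists_character_top
  obtain ⟨y, hy0, hy, -⟩ := hT.exists_generator_top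
  have hχt : χ t = 1 :=
    (hχu t y hy0 1 (by rw [one_smul]; exact ht.smul_eq_self hy)).symm
  have hM : ∀ (k : ℕ) (a : R) (x : LoewyLayer R M k), a • t • x = χ a • t • x :=
    fun k => h.smul_smul_layer ht hy0 hy fun a => hχ a y
  refine ⟨fun k => ?_, fun k hQT hk => ?_, hpos⟩
  · obtain ⟨X, hX, hXe⟩ := h.exists_span_eigen_loewyLayer k
    have := h.isSemisimpleModule_of_span_charValue hX fun x hx =>
      (hXe x hx).imp fun _ hT => hT.1
    rw [occursAsSummand_iff_exists_smul_ne_zero χ hχt hT.finrank_top hχ (hM k)]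
    constructor
    · rintro ⟨x, hx⟩
      obtain ⟨h1, h2⟩ := h.refines_of_smul_ne_zero ht hx
      exact ⟨h1, by omega⟩
    · rintro ⟨h1, h2⟩
      by_contra hcon
      push Not at hcon
      have h3 : rankOn F t (LoewyLayer R M k) = 0 := rankOn_eq_zero_iff.2 hcon
      rw [h.rankOn_layer ht (by omega)] at h3
      exact (hpos.2 h1).ne' h3
  · rw [← h.rankOn_layer ht (k := k) (by omega)]
    exact hasSummandMultiplicity_rankOn ht.isIdempotentElem χ hχt hT.finrank_top hχ (hM k)
      h.smul_comm_layer

end WordModel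

end

end SolomonTits


namespace SolomonTits

noncomputable section

open SolomonTits.Comp

variable {F : Type*} [Field F] {A : Finset ℕ+} {Q T P : Comp A}

/-! ### The left ideals of the Solomon-Tits algebra -/

theorem span_range_single :
    Submodule.span F (Set.range fun P : Comp A => (MonoidAlgebra.single P 1 : Alg F A)) = ⊤ := by
  rw [eq_top_iff]
  intro x _
  induction x using MonoidAlgebra.induction_linear with
  | zero => exact zero_mem _
  | add x y hx hy => exact add_mem (hx trivial) (hy trivial)
  | single P c =>
    rw [← mul_one c, ← smul_eq_mul, ← MonoidAlgebra.smul_single]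
    exact Submodule.smul_mem _ _ (Submodule.subset_span ⟨P, rfl⟩)

instance : FiniteDimensional F (Alg F A) :=
  ⟨(Submodule.fg_def).2 ⟨_, Set.finite_range _, span_range_single⟩⟩

variable (F Q) in
/-- The words of the elements of `Λ_Q`. -/
def lamToWords : Lam F Q →ₗ[F] WAlg F :=
  toWords F A ∘ₗ (Lam F Q).subtype.restrictScalars F

theorem wordModel_lam :
    WordModel Q (fun P => (MonoidAlgebra.single P 1 : Alg F A)) (lamToWords F Q) where
  span_range := span_range_single
  injective := toWords_injective.comp Subtype.val_injective
  map_smul P x := toWords_single_mul P x.1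
  generator := by
    refine ⟨⟨e F Q, Submodule.mem_span_singleton_self _⟩, ?_, toWords_e Q⟩
    rw [eq_top_iff]
    rintro ⟨x, hx⟩ -
    obtain ⟨a, rfl⟩ := Submodule.mem_span_singleton.1 hx
    exact Submodule.mem_span_singleton.2 ⟨a, rfl⟩

theorem parts_eq_map_unionL (T : Comp A) : T.parts = (T.parts.map fun q => [q]).map unionL := by
  simp [unionL, Function.comp_def]

theorem single_mul_e_self (T : Comp A) : MonoidAlgebra.single T 1 * e F T = e F T := by
  refine toWords_injective ?_
  rw [toWords_single_mul, toWords_e,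
    act_brackets_of_parts_eq (List.Perm.refl _) (parts_eq_map_unionL T)]

theorem single_mul_e_eq_zero (h : ¬ T.Refines P) : MonoidAlgebra.single P 1 * e F T = 0 := by
  refine toWords_injective ?_
  rw [toWords_single_mul, toWords_e,
    act_brackets_of_not_refines (Grouping.singletons T) (parts_eq_map_unionL T) h, map_zero]

theorem single_mul_mem (T : Comp A) (x : Alg F A) : MonoidAlgebra.single T 1 * x ∈
    Submodule.span F ((fun P : Comp A => (MonoidAlgebra.single P 1 : Alg F A)) ''
      {P | P.Refines T}) := by
  induction x using MonoidAlgebra.induction_linear with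
  | zero => rw [mul_zero]; exact zero_mem _
  | add x y hx hy => rw [mul_add]; exact add_mem hx hy
  | single P c =>
    have h : (MonoidAlgebra.single T 1 * MonoidAlgebra.single P c : Alg F A) =
        c • MonoidAlgebra.single (T * P) 1 := by simp [MonoidAlgebra.single_mul_single]
    rw [h]
    exact Submodule.smul_mem _ _ (Submodule.subset_span ⟨T * P, mul_refines_left T P, rfl⟩)

theorem keep_toWords_e (T : Comp A) :
    keep F T.parts (toWords F A (e F T)) = toWords F A (MonoidAlgebra.single T 1) := by
  rw [toWords_e, toWords_single]
  have key : ∀ l : List (Finset ℕ+), (∀ X ∈ l, X ∈ T.parts) →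
      keep F T.parts (brackets F (l.map fun q => [q])) =
        MonoidAlgebra.single (FreeMonoid.ofList l) 1 := by
    intro l hl
    induction l with
    | nil => exact map_one _
    | cons X l ih =>
      have hX := hl X List.mem_cons_self
      have h1 : brackets F ((X :: l).map fun q => [q]) =
          ePoly F X * brackets F (l.map fun q => [q]) := by
        simp [brackets, bracket]
      rw [h1, map_mul, keep_ePoly T.pairwise_disjoint_parts (T.val.nonempty X hX) hX,
        ih fun Y hY => hl Y (List.mem_cons_of_mem _ hY), MonoidAlgebra.single_mul_single, one_mul,
        FreeMonoid.ofList_cons]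
  exact key _ fun _ h => h

theorem refines_of_forall_mem (h : ∀ p ∈ P.parts, p ∈ T.parts) : T.Refines P := by
  intro q hq
  obtain ⟨a, ha⟩ := T.val.nonempty q hq
  obtain ⟨p, hp, hap⟩ := P.exists_mem_of_mem (subset_of_mem hq ha)
  exact ⟨p, hp, (eq_of_mem_of_mem T.pairwise_disjoint_parts (h p hp) hq hap ha).ge⟩

/-- As `e_T = T e_T`, only refinements of `T` occur in `e_T`. Those that `T` refines in turn are the
rearrangements of `T`; `keep` retains exactly these and leaves `T` alone with coefficient 1. -/
theorem e_sub_single_mem (T : Comp A) : e F T - MonoidAlgebra.single T 1 ∈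
    Submodule.span F ((fun P : Comp A => (MonoidAlgebra.single P 1 : Alg F A)) ''
      {P | ¬ T.Refines P}) := by
  set V := Submodule.span F ((fun P : Comp A => (MonoidAlgebra.single P 1 : Alg F A)) ''
      {P | ¬ T.Refines P})
  have key : ∀ y ∈ Submodule.span F
      ((fun P : Comp A => (MonoidAlgebra.single P 1 : Alg F A)) '' {P | P.Refines T}),
      ∃ z, y - z ∈ V ∧ keep F T.parts (toWords F A y) = toWords F A z := by
    intro y hy
    induction hy using Submodule.span_induction with
    | mem y hy =>
      obtain ⟨P, hP, rfl⟩ := hy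
      by_cases hTP : T.Refines P
      · refine ⟨MonoidAlgebra.single P 1, by simp, ?_⟩
        simp only [toWords_single]
        exact keep_single_of_forall_mem (fun p hp => Refines.mem hP hTP hp) 1
      · refine ⟨0, ?_, ?_⟩
        · rw [sub_zero]
          exact Submodule.subset_span ⟨P, hTP, rfl⟩
        · simp only [toWords_single, map_zero]
          refine keep_single_of_exists_notMem ?_ 1
          by_contra! hcon
          exact hTP (refines_of_forall_mem hcon)
    | zero => exact ⟨0, by simp, by simp⟩
    | add x y _ _ hx hy =>
      obtain ⟨z, hz, hz'⟩ := hx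
      obtain ⟨u, hu, hu'⟩ := hy
      refine ⟨z + u, ?_, by rw [map_add, map_add, map_add, hz', hu']⟩
      rw [add_sub_add_comm]
      exact add_mem hz hu
    | smul c x _ hx =>
      obtain ⟨z, hz, hz'⟩ := hx
      refine ⟨c • z, ?_, by rw [map_smul, map_smul, map_smul, hz']⟩
      rw [← smul_sub]
      exact Submodule.smul_mem _ _ hz
  obtain ⟨z, hz, hz'⟩ := key _ (single_mul_mem T (e F T))
  rw [single_mul_e_self] at hz hz'
  rw [keep_toWords_e] at hz'
  rwa [toWords_injective hz']

theorem isPrimitiveFor_e (T : Comp A) :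
    IsPrimitiveFor F T (fun P => (MonoidAlgebra.single P 1 : Alg F A)) (e F T) where
  sub_mem := e_sub_single_mem T
  mul_self := single_mul_e_self T
  mul_eq_zero _ := single_mul_e_eq_zero

end

end SolomonTits

theorem corollary7p3 (F : Type*) [Field F] (A : Finset ℕ+) (Q T : SolomonTits.Comp A)
    (hQ : Q.IsIncreasing) (hT : T.IsIncreasing) :
    (∀ k : ℕ,
      SolomonTits.OccursAsSummand (SolomonTits.Alg F A)
          (SolomonTits.LoewyLayer (SolomonTits.Alg F A) (SolomonTits.Lam F Q) k)
          (SolomonTits.Simp F T) ↔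
        Q.Refines T ∧ (Q.length : ℤ) - (T.length : ℤ) = k) ∧
    (∀ k : ℕ, Q.Refines T → (Q.length : ℤ) - (T.length : ℤ) = k →
      SolomonTits.HasSummandMultiplicity (SolomonTits.Alg F A)
          (SolomonTits.LoewyLayer (SolomonTits.Alg F A) (SolomonTits.Lam F Q) k)
          (SolomonTits.Simp F T) (SolomonTits.cartan F T Q)) ∧
    (0 < SolomonTits.cartan F T Q ↔ Q.Refines T) := by
  have : FiniteDimensional F (SolomonTits.Lam F Q) :=
    inferInstanceAs (FiniteDimensional F ((SolomonTits.Lam F Q).restrictScalars F))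
  exact SolomonTits.WordModel.loewy_multiplicities SolomonTits.wordModel_lam
    (SolomonTits.isPrimitiveFor_e T) SolomonTits.wordModel_lam
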